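/- A finite set $P$ of points in the plane is called a conowheel set if no three points of $P$ lie on a common line and at most one point of $P$ is not a vertex of the convex hull of $P$. Two finite planar point sets have the same order type if there is a bijection between them that preserves the orientations (clockwise or counterclockwise) of all ordered triples of points, or a bijection that reverses all of them (so reflected point sets have the same order type). Then, for every $n \geq 1$, the number of order types of conowheel sets of size $n+1$ is $$\frac{1}{4n}\sum_{\substack{k \mid n\\ 2\nmid k}} \varphi(k)\,2^{n/k} + 2^{\lfloor (n-3)/2\rfloor},$$ where $\varphi$ denotes Euler's totient function; and this number is $\Theta(2^n/n)$ as $n \to \infty$. -/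

import Mathlib

open scoped Asymptotics

namespace Conowheel

/-- The Euclidean plane. -/
abbrev Plane : Type := EuclideanSpace ℝ (Fin 2)

/-- Orientation of an ordered triple of points, the sign of `det (b - a, c - a)`:
`1` is counterclockwise, `-1` is clockwise, `0` is collinear. -/
noncomputable def orient (a b c : Plane) : SignType :=
  SignType.sign ((b 0 - a 0) * (c 1 - a 1) - (b 1 - a 1) * (c 0 - a 0))

/-- No three points of `P` lie on a common line. -/
def GeneralPosition (P : Finset Plane) : Prop :=
  ∀ a ∈ P, ∀ b ∈ P, ∀ c ∈ P, a ≠ b → a ≠ c → b ≠ c → ¬ Collinear ℝ ({a, b, c} : Set Plane)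

/-- `p` is a vertex of the convex hull of `P`. -/
def IsHullVertex (P : Finset Plane) (p : Plane) : Prop :=
  p ∈ (convexHull ℝ (P : Set Plane)).extremePoints ℝ

/-- All points of `P` are extreme. -/
def IsConvexPosition (P : Finset Plane) : Prop :=
  ∀ p ∈ P, IsHullVertex P p

/-- All points of `P` are extreme, except for exactly one point `w`. -/
def IsWheelSet (P : Finset Plane) : Prop :=
  ∃ w ∈ P, ¬ IsHullVertex P w ∧ ∀ h ∈ P, h ≠ w → IsHullVertex P h

/-- A point set in general position that is in convex position or a wheel set. -/
def IsConowheelSet (P : Finset Plane) : Prop :=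
  GeneralPosition P ∧ (IsConvexPosition P ∨ IsWheelSet P)

/-- `P` and `Q` have the same order type: some bijection preserves all orientations, or some
bijection reverses all orientations. -/
def SameOrderType (P Q : Finset Plane) : Prop :=
  ∃ f : P ≃ Q,
    (∀ a b c : P, orient (f a) (f b) (f c) = orient a b c) ∨
    (∀ a b c : P, orient (f a) (f b) (f c) = - orient a b c)

theorem SameOrderType.refl (P : Finset Plane) : SameOrderType P P :=
  ⟨Equiv.refl _, Or.inl fun _ _ _ => rfl⟩

theorem SameOrderType.symm {P Q : Finset Plane} (h : SameOrderType P Q) : SameOrderType Q P := by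
  obtain ⟨f, hf | hf⟩ := h
  · refine ⟨f.symm, Or.inl fun a b c => ?_⟩
    simpa using (hf (f.symm a) (f.symm b) (f.symm c)).symm
  · refine ⟨f.symm, Or.inr fun a b c => ?_⟩
    have h := hf (f.symm a) (f.symm b) (f.symm c)
    simp only [Equiv.apply_symm_apply] at h
    rw [h, neg_neg]

theorem SameOrderType.trans {P Q R : Finset Plane} (h : SameOrderType P Q)
    (h' : SameOrderType Q R) : SameOrderType P R := by
  obtain ⟨f, hf | hf⟩ := h <;> obtain ⟨g, hg | hg⟩ := h'
  · exact ⟨f.trans g, Or.inl fun a b c => by simp [hf, hg]⟩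
  · exact ⟨f.trans g, Or.inr fun a b c => by simp [hf, hg]⟩
  · exact ⟨f.trans g, Or.inr fun a b c => by simp [hf, hg]⟩
  · exact ⟨f.trans g, Or.inl fun a b c => by simp [hf, hg]⟩

/-- The conowheel sets with exactly `m` points. -/
abbrev ConowheelSetOfSize (m : ℕ) : Type :=
  {P : Finset Plane // IsConowheelSet P ∧ P.card = m}

/-- Having the same order type, as an equivalence relation on conowheel sets with `m` points. -/
def orderTypeSetoid (m : ℕ) : Setoid (ConowheelSetOfSize m) where
  r P Q := SameOrderType P.1 Q.1
  iseqv := ⟨fun P => .refl P.1, fun h => h.symm, fun h h' => h.trans h'⟩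

/-- The order types (up to reflection) of conowheel sets with `m` points. -/
abbrev OrderType (m : ℕ) : Type := Quotient (orderTypeSetoid m)

end Conowheel

/-! Fix a hub `w`: the non-extreme point, or any point if the set is convex. All other points are
extreme, which forces the orientation of a triple avoiding `w` to be the majority of the three
orientations seen from `w` (`IsHub.orient_eq_majority`). So only the rotation system around `w`
matters. The `n` lines joining `w` to the other points give `2n` cyclically ordered directions, and
each point picks one direction of its antipodal pair. This is an antiperiodic 0/1 function on `ZMod
(2 * n)`, a `Coloring`. Every coloring occurs, realised by the center of a circle and points on it.

Two colorings give the same order type iff they are related by the dihedral group of order `4n`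
(`nonempty_orbits_equiv_orderType`). A bijection matching the hubs preserves or reverses the cyclic
order, so it comes from a rotation or reflection. If the hubs are not matched, neither lies inside a
triangle of the other points, so both colorings are blocks of `n` consecutive directions and differ
by a rotation.

Burnside's lemma then counts orbits. A rotation of order `k` fixes `2 ^ (n / k)` colorings for odd
`k` and none for even `k`. Half of the `2n` reflections fix `2 ^ ⌈n/2⌉` colorings, the other half
none. Dividing by `4n` gives the formula. The term `k = 1` dominates, whence `Θ(2 ^ n / n)`. -/

namespace Conowheel

/-! ### Orientations around a hub determine the order type. -/

section

/-- Twice the signed area of the triangle `a b c`. -/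
def det (a b c : Plane) : ℝ :=
  (b 0 - a 0) * (c 1 - a 1) - (b 1 - a 1) * (c 0 - a 0)

theorem orient_eq_sign_det (a b c : Plane) : orient a b c = SignType.sign (det a b c) := rfl

theorem det_rotate (a b c : Plane) : det b c a = det a b c := by
  unfold det; ring

theorem det_swap (a b c : Plane) : det a c b = -det a b c := by
  unfold det; ring

theorem det_eq_add (w a b c : Plane) : det a b c = det w a b + det w b c + det w c a := by
  unfold det; ring

theorem orient_rotate (a b c : Plane) : orient b c a = orient a b c := by
  rw [orient_eq_sign_det, det_rotate, orient_eq_sign_det]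

theorem orient_swap (a b c : Plane) : orient a c b = -orient a b c := by
  rw [orient_eq_sign_det, det_swap, Left.sign_neg, orient_eq_sign_det]

theorem orient_self_left (a b : Plane) : orient a a b = 0 := by
  simp [orient_eq_sign_det, det]

theorem orient_self_right (a b : Plane) : orient a b b = 0 := by
  rw [← orient_rotate, orient_self_left]

theorem orient_self_outer (a b : Plane) : orient a b a = 0 := by
  rw [orient_rotate a a b, orient_self_left]

theorem collinear_iff_orient_eq_zero {a b c : Plane} (hab : a ≠ b) :
    Collinear ℝ ({a, b, c} : Set Plane) ↔ orient a b c = 0 := by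
  rw [orient_eq_sign_det, sign_eq_zero_iff,
    collinear_iff_of_mem (p₀ := a) (by simp)]
  constructor
  · rintro ⟨v, hv⟩
    obtain ⟨r, rfl⟩ := hv b (by simp)
    obtain ⟨s, rfl⟩ := hv c (by simp)
    simp [det]; ring
  · intro h
    refine ⟨b - a, ?_⟩
    intro p hp
    simp only [Set.mem_insert_iff, Set.mem_singleton_iff] at hp
    rcases hp with rfl | rfl | rfl
    · exact ⟨0, by simp⟩
    · exact ⟨1, by simp⟩
    · unfold det at h
      by_cases h0 : b 0 - a 0 = 0
      · have h1 : b 1 - a 1 ≠ 0 := fun h1 => hab <| by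
          ext i; fin_cases i <;> simp <;> linarith
        refine ⟨(p 1 - a 1) / (b 1 - a 1), ?_⟩
        ext i; fin_cases i <;> simp
        · rw [h0] at h
          have : p 0 - a 0 = 0 := by
            have : (b 1 - a 1) * (p 0 - a 0) = 0 := by linarith
            exact (mul_eq_zero.1 this).resolve_left h1
          rw [h0]; linarith
        · field_simp; ring
      · refine ⟨(p 0 - a 0) / (b 0 - a 0), ?_⟩
        ext i; fin_cases i <;> simp
        · field_simp; ring
        · field_simp; linarith

theorem GeneralPosition.orient_ne_zero {P : Finset Plane} (hP : GeneralPosition P) {a b c : Plane}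
    (ha : a ∈ P) (hb : b ∈ P) (hc : c ∈ P) (hab : a ≠ b) (hac : a ≠ c) (hbc : b ≠ c) :
    orient a b c ≠ 0 := fun h =>
  hP a ha b hb c hc hab hac hbc ((collinear_iff_orient_eq_zero hab).2 h)

/-- `p` is surrounded by a counterclockwise triangle with vertices in `P`. -/
def IsSurrounded (P : Finset Plane) (p : Plane) : Prop :=
  ∃ a ∈ P, ∃ b ∈ P, ∃ c ∈ P, orient p a b = 1 ∧ orient p b c = 1 ∧ orient p c a = 1

/-- Being surrounded is a purely order-theoretic obstruction to extremality. The argument never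
needs the converse. -/
theorem IsHullVertex.not_isSurrounded {P : Finset Plane} {p : Plane} (hp : IsHullVertex P p) :
    ¬ IsSurrounded P p := by
  rintro ⟨a, ha, b, hb, c, hc, h1, h2, h3⟩
  have hmem := ((convex_convexHull ℝ (P : Set Plane)).mem_extremePoints_iff_mem_sdiff_convexHull_sdiff).1 hp
  refine hmem.2 ?_
  have key : ∀ q ∈ P, q ≠ p → q ∈ convexHull ℝ (P : Set Plane) \ {p} := fun q hq hne =>
    ⟨subset_convexHull ℝ _ (by simpa using hq), by simpa using hne⟩
  have hap : a ≠ p := by rintro rfl; simp [orient_self_left] at h1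
  have hbp : b ≠ p := by rintro rfl; simp [orient_self_left] at h2
  have hcp : c ≠ p := by rintro rfl; simp [orient_self_left] at h3
  have hconv := convex_convexHull ℝ (convexHull ℝ (P : Set Plane) \ {p})
  rw [orient_eq_sign_det, sign_eq_one_iff] at h1 h2 h3
  have hs : 0 < det p a b + det p b c + det p c a := by positivity
  -- The weights are the barycentric coordinates of `p` in the triangle `a b c`.
  have hcomb := hconv.sum_mem (t := Finset.univ)
    (w := ![det p b c / (det p a b + det p b c + det p c a),
      det p c a / (det p a b + det p b c + det p c a),
      det p a b / (det p a b + det p b c + det p c a)]) (z := ![a, b, c])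
    (by intro i _; fin_cases i <;> simp <;> positivity)
    (by simp [Fin.sum_univ_three]; field_simp; ring)
    (by
      intro i _
      fin_cases i
      · exact subset_convexHull ℝ _ (key a ha hap)
      · exact subset_convexHull ℝ _ (key b hb hbp)
      · exact subset_convexHull ℝ _ (key c hc hcp))
  convert hcomb using 1
  ext i
  fin_cases i <;> simp [Fin.sum_univ_three] <;> field_simp <;> unfold det <;> ring

theorem isSurrounded_of_orient_map {P Q : Finset Plane} (f : P → Q) (p : P)
    (h : (∀ a b c : P, orient (f a) (f b) (f c) = orient a b c) ∨
      (∀ a b c : P, orient (f a) (f b) (f c) = - orient a b c))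
    (hp : IsSurrounded P p) : IsSurrounded Q (f p) := by
  obtain ⟨a, ha, b, hb, c, hc, h1, h2, h3⟩ := hp
  rcases h with h | h
  · exact ⟨f ⟨a, ha⟩, (f _).2, f ⟨b, hb⟩, (f _).2, f ⟨c, hc⟩, (f _).2, by simpa [h] using
      ⟨h1, h2, h3⟩⟩
  -- A reversing map makes the triangle clockwise, so it is read backwards.
  · refine ⟨f ⟨c, hc⟩, (f _).2, f ⟨b, hb⟩, (f _).2, f ⟨a, ha⟩, (f _).2, ?_⟩
    simp only [h]
    rw [← orient_swap, ← orient_swap, ← orient_swap]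
    exact ⟨h2, h1, h3⟩

/-- `P` is in general position and all its points except possibly `w` are extreme. -/
structure IsHub (P : Finset Plane) (w : Plane) : Prop where
  mem : w ∈ P
  generalPosition : GeneralPosition P
  isHullVertex : ∀ h ∈ P, h ≠ w → IsHullVertex P h

theorem IsConowheelSet.exists_isHub {P : Finset Plane} (hP : IsConowheelSet P)
    (hne : P.Nonempty) : ∃ w, IsHub P w := by
  obtain ⟨hg, hc | ⟨w, hw, -, h⟩⟩ := hP
  · obtain ⟨w, hw⟩ := hne
    exact ⟨w, hw, hg, fun h hh _ => hc h hh⟩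
  · exact ⟨w, hw, hg, h⟩

theorem IsHub.isConowheelSet {P : Finset Plane} {w : Plane} (h : IsHub P w) :
    IsConowheelSet P := by
  refine ⟨h.generalPosition, ?_⟩
  by_cases hw : IsHullVertex P w
  · left
    intro p hp
    by_cases hpw : p = w
    · exact hpw ▸ hw
    · exact h.isHullVertex p hp hpw
  · exact Or.inr ⟨w, h.mem, hw, h.isHullVertex⟩

/-- The majority of three signs. -/
noncomputable def majority (x y z : SignType) : SignType := SignType.sign ((x : ℤ) + y + z)

theorem majority_mul (s x y z : SignType) :
    majority (s * x) (s * y) (s * z) = s * majority x y z := by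
  revert s x y z; decide

/-- Here `b` is the middle one of three rays within a half-plane at `w`. If `a b c` were clockwise,
`b` would lie inside the triangle `w a c`, contradicting extremality. -/
theorem IsHub.orient_eq_one {P : Finset Plane} {w : Plane} (h : IsHub P w) {a b c : Plane}
    (ha : a ∈ P) (hb : b ∈ P) (hc : c ∈ P) (hbw : b ≠ w)
    (h1 : orient w a b = 1) (h2 : orient w b c = 1) (h3 : orient w c a = -1) :
    orient a b c = 1 := by
  have hab : a ≠ b := by rintro rfl; simp [orient_self_right] at h1
  have hbc : b ≠ c := by rintro rfl; simp [orient_self_right] at h2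
  have hac : a ≠ c := by rintro rfl; simp [orient_self_right] at h3
  have h0 := h.generalPosition.orient_ne_zero ha hb hc hab hac hbc
  rcases h4 : orient a b c with _ | _ | _
  · exact absurd h4 h0
  · refine absurd ?_ (h.isHullVertex b hb hbw).not_isSurrounded
    refine ⟨w, h.mem, a, ha, c, hc, ?_, ?_, ?_⟩
    · exact (orient_rotate a b w).trans ((orient_rotate w a b).trans h1)
    · rw [orient_swap, orient_rotate, h4]; rfl
    · rw [← orient_rotate, ← orient_rotate, h2]
  · rfl

/-- Three equal signs put `w` inside the triangle, and the signed areas add up by `det_eq_add`.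
Otherwise one sign differs, and `IsHub.orient_eq_one` applies after a rotation (`p1`–`p3`) or a
reversal (`q1`–`q3`) of the triple. For repeated points the signs cancel. -/
theorem IsHub.orient_eq_majority {P : Finset Plane} {w : Plane} (h : IsHub P w) {a b c : Plane}
    (ha : a ∈ P) (hb : b ∈ P) (hc : c ∈ P) (haw : a ≠ w) (hbw : b ≠ w) (hcw : c ≠ w) :
    orient a b c = majority (orient w a b) (orient w b c) (orient w c a) := by
  by_cases hab : a = b
  · subst hab
    rw [orient_self_left, orient_self_right, orient_swap w a c]
    generalize orient w a c = x
    revert x; decide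
  by_cases hbc : b = c
  · subst hbc
    rw [orient_self_right, orient_self_right, orient_swap w a b]
    generalize orient w a b = x
    revert x; decide
  by_cases hac : a = c
  · subst hac
    rw [orient_self_outer, orient_self_right, orient_swap w a b]
    generalize orient w a b = x
    revert x; decide
  have n1 := h.generalPosition.orient_ne_zero h.mem ha hb haw.symm hbw.symm hab
  have n2 := h.generalPosition.orient_ne_zero h.mem hb hc hbw.symm hcw.symm hbc
  have n3 := h.generalPosition.orient_ne_zero h.mem hc ha hcw.symm haw.symm (Ne.symm hac)
  have p1 := h.orient_eq_one ha hb hc hbw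
  have p2 := h.orient_eq_one hb hc ha hcw
  have p3 := h.orient_eq_one hc ha hb haw
  have q1 := h.orient_eq_one hc hb ha hbw
  have q2 := h.orient_eq_one hb ha hc haw
  have q3 := h.orient_eq_one ha hc hb hcw
  rw [orient_rotate a b c] at p2
  rw [← orient_rotate c a b] at p3
  rw [orient_swap c a b, ← orient_rotate c a b, orient_swap w b c, orient_swap w a b,
    orient_swap w c a] at q1
  rw [orient_swap b c a, orient_rotate a b c, orient_swap w a b, orient_swap w c a,
    orient_swap w b c] at q2
  rw [orient_swap a b c, orient_swap w c a, orient_swap w b c, orient_swap w a b] at q3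
  have hdet := det_eq_add w a b c
  have s1 : orient w a b = 1 → orient w b c = 1 → orient w c a = 1 → orient a b c = 1 := by
    simp only [orient_eq_sign_det, sign_eq_one_iff]
    intros; linarith
  have s2 : orient w a b = -1 → orient w b c = -1 → orient w c a = -1 → orient a b c = -1 := by
    simp only [orient_eq_sign_det, sign_eq_neg_one_iff]
    intros; linarith
  generalize orient w a b = x at *
  generalize orient w b c = y at *
  generalize orient w c a = z at *
  generalize orient a b c = t at *
  clear hdet
  have hcases : ∀ x : SignType, x ≠ 0 → x = 1 ∨ x = -1 := by decide
  rcases hcases x n1 with rfl | rfl <;> rcases hcases y n2 with rfl | rfl <;>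
    rcases hcases z n3 with rfl | rfl <;>
    first
    | (rw [s1 rfl rfl rfl]; decide)
    | (rw [s2 rfl rfl rfl]; decide)
    | (rw [p1 rfl rfl rfl]; decide)
    | (rw [p2 rfl rfl rfl]; decide)
    | (rw [p3 rfl rfl rfl]; decide)
    | (rw [neg_eq_iff_eq_neg.1 (q1 rfl rfl rfl)]; decide)
    | (rw [neg_eq_iff_eq_neg.1 (q2 rfl rfl rfl)]; decide)
    | (rw [neg_eq_iff_eq_neg.1 (q3 rfl rfl rfl)]; decide)

/-- Extend `g` by `w ↦ u`. Triples avoiding the hub follow because the majority commutes with a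
global sign. -/
theorem IsHub.sameOrderType {P Q : Finset Plane} {w u : Plane} (hP : IsHub P w) (hQ : IsHub Q u)
    (g : {h // h ∈ P ∧ h ≠ w} ≃ {h // h ∈ Q ∧ h ≠ u}) (s : SignType) (hs : s ≠ 0)
    (hg : ∀ a b, orient u (g a) (g b) = s * orient w a b) : SameOrderType P Q := by
  classical
  let F : P → Q := fun p => if hp : (p : Plane) = w then ⟨u, hQ.mem⟩ else
    ⟨g ⟨p, p.2, hp⟩, (g ⟨p, p.2, hp⟩).2.1⟩
  have F1 : ∀ p : P, (p : Plane) = w → (F p : Plane) = u := fun p hp => by simp [F, hp]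
  have F2 : ∀ (p : P) (hp : (p : Plane) ≠ w), (F p : Plane) = g ⟨p, p.2, hp⟩ := fun p hp => by
    simp [F, hp]
  have hbij : Function.Bijective F := by
    constructor
    · intro p q hpq
      have hpq' : (F p : Plane) = F q := by rw [hpq]
      by_cases hp : (p : Plane) = w <;> by_cases hq : (q : Plane) = w
      · exact Subtype.ext (hp.trans hq.symm)
      · rw [F1 p hp, F2 q hq] at hpq'
        exact absurd hpq'.symm (g _).2.2
      · rw [F1 q hq, F2 p hp] at hpq'
        exact absurd hpq' (g _).2.2
      · rw [F2 p hp, F2 q hq] at hpq'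
        have := g.injective (Subtype.ext hpq')
        exact Subtype.ext (congrArg (fun x => x.1) this)
    · rintro ⟨q, hq⟩
      by_cases hqu : q = u
      · exact ⟨⟨w, hP.mem⟩, Subtype.ext ((F1 _ rfl).trans hqu.symm)⟩
      · obtain ⟨⟨p, hp, hpw⟩, hgp⟩ := g.surjective ⟨q, hq, hqu⟩
        exact ⟨⟨p, hp⟩, Subtype.ext (by rw [F2 _ hpw, hgp])⟩
  have hw : ∀ a b c : P, (a : Plane) = w → orient (F a) (F b) (F c) = s * orient a b c := by
    intro a b c ha
    rw [F1 a ha, ha]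
    by_cases hb : (b : Plane) = w
    · rw [F1 b hb, hb, orient_self_left, orient_self_left, mul_zero]
    by_cases hc : (c : Plane) = w
    · rw [F1 c hc, hc, orient_self_outer, orient_self_outer, mul_zero]
    rw [F2 b hb, F2 c hc, hg]
  have hF : ∀ a b c : P, orient (F a) (F b) (F c) = s * orient a b c := by
    intro a b c
    by_cases ha : (a : Plane) = w
    · exact hw a b c ha
    by_cases hb : (b : Plane) = w
    · rw [← orient_rotate, hw b c a hb, orient_rotate]
    by_cases hc : (c : Plane) = w
    · rw [← orient_rotate, ← orient_rotate, hw c a b hc, orient_rotate, orient_rotate]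
    rw [hP.orient_eq_majority a.2 b.2 c.2 ha hb hc,
      hQ.orient_eq_majority (F a).2 (F b).2 (F c).2
        (by rw [F2 a ha]; exact (g _).2.2) (by rw [F2 b hb]; exact (g _).2.2)
        (by rw [F2 c hc]; exact (g _).2.2), F2 a ha, F2 b hb, F2 c hc, hg, hg, hg, majority_mul]
  refine ⟨Equiv.ofBijective F hbij, ?_⟩
  rcases h : s with _ | _ | _
  · exact absurd h hs
  · right; intro a b c
    simpa [h] using hF a b c
  · left; intro a b c
    simpa [h] using hF a b c

end

/-! ### Antipodal colorings of the `2n` directions and their cyclic order. -/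

section

variable {n : ℕ}

theorem half_add_half : (n : ZMod (2 * n)) + n = 0 := by
  have := ZMod.natCast_self (2 * n)
  push_cast at this
  rw [← this]; ring

theorem neg_half : -(n : ZMod (2 * n)) = n := by
  rw [neg_eq_iff_add_eq_zero, half_add_half]

theorem add_half_add_half (x : ZMod (2 * n)) : x + n + n = x := by
  rw [add_assoc, half_add_half, add_zero]

/-- The sets of directions containing exactly one direction from each antipodal pair. -/
structure Coloring (n : ℕ) : Type where
  /-- The indicator function of the set of directions. -/
  toFun : ZMod (2 * n) → Bool
  map_add_half : ∀ x, toFun (x + n) = !toFun x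

instance : CoeFun (Coloring n) fun _ => ZMod (2 * n) → Bool := ⟨Coloring.toFun⟩

theorem Coloring.add_half (b : Coloring n) (x : ZMod (2 * n)) : b (x + n) = !b x := b.2 x

theorem Coloring.toFun_injective : Function.Injective (Coloring.toFun (n := n)) := by
  rintro ⟨b, _⟩ ⟨c, _⟩ h
  simpa using h

theorem Coloring.ext {b c : Coloring n} (h : ∀ x, b x = c x) : b = c :=
  Coloring.toFun_injective (funext h)

variable [NeZero n]

theorem half_ne_zero : (n : ZMod (2 * n)) ≠ 0 := by
  have h0 := NeZero.pos n
  intro h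
  rw [ZMod.natCast_eq_zero_iff] at h
  have := Nat.le_of_dvd h0 h
  omega

theorem val_half : (n : ZMod (2 * n)).val = n := by
  have h0 := NeZero.pos n
  rw [ZMod.val_natCast, Nat.mod_eq_of_lt (by omega)]

/-- The orientation of the directions with angles `0` and `π d / n`. -/
noncomputable def turn (d : ZMod (2 * n)) : SignType := SignType.sign (ZMod.toCircle d : ℂ).im

theorem turn_neg (d : ZMod (2 * n)) : turn (-d) = -turn d := by
  rw [turn, turn, AddChar.map_neg_eq_inv, Circle.coe_inv_eq_conj, Complex.conj_im, Left.sign_neg]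

theorem toCircle_half : (ZMod.toCircle (n : ZMod (2 * n)) : ℂ) = -1 := by
  have h0 : (n : ℂ) ≠ 0 := Nat.cast_ne_zero.2 (NeZero.ne n)
  rw [ZMod.toCircle_natCast, ← Complex.exp_pi_mul_I]
  congr 1
  push_cast
  field_simp

theorem turn_add_half (d : ZMod (2 * n)) : turn (d + n : ZMod (2 * n)) = -turn d := by
  rw [turn, turn, AddChar.map_add_eq_mul, Circle.coe_mul, toCircle_half, mul_neg_one,
    Complex.neg_im, Left.sign_neg]

theorem turn_zero : turn (0 : ZMod (2 * n)) = 0 := by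
  simp [turn]

theorem turn_half : turn (n : ZMod (2 * n)) = 0 := by
  rw [← zero_add (n : ZMod (2 * n)), turn_add_half, turn_zero, neg_zero]

theorem turn_sub_comm (x y : ZMod (2 * n)) : turn (x - y) = -turn (y - x) := by
  rw [← turn_neg, neg_sub]

theorem turn_natCast_eq_one {k : ℕ} (h1 : 0 < k) (h2 : k < n) : turn (k : ZMod (2 * n)) = 1 := by
  have h0 : (0 : ℝ) < n := Nat.cast_pos.2 (NeZero.pos n)
  have h1' : (0 : ℝ) < k := Nat.cast_pos.2 h1
  have h2' : (k : ℝ) < n := Nat.cast_lt.2 h2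
  have : (ZMod.toCircle (k : ZMod (2 * n)) : ℂ) = Complex.exp ((Real.pi * k / n : ℝ) * Complex.I) := by
    rw [ZMod.toCircle_natCast]
    congr 1
    push_cast
    field_simp
  rw [turn, this, Complex.exp_ofReal_mul_I_im, sign_eq_one_iff]
  apply Real.sin_pos_of_pos_of_lt_pi
  · positivity
  · rw [div_lt_iff₀ h0]
    exact mul_lt_mul_of_pos_left h2' Real.pi_pos

theorem exists_natCast (d : ZMod (2 * n)) : ∃ k < n, d = k ∨ d = k + n := by
  have hlt := ZMod.val_lt d
  by_cases h : d.val < n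
  · exact ⟨d.val, h, Or.inl (by simp)⟩
  · refine ⟨d.val - n, by omega, Or.inr ?_⟩
    rw [← Nat.cast_add, Nat.sub_add_cancel (by omega)]
    simp

theorem exists_natCast_of_turn_eq_one {d : ZMod (2 * n)} (h : turn d = 1) :
    ∃ k : ℕ, 0 < k ∧ k < n ∧ d = k := by
  obtain ⟨k, hk, rfl | rfl⟩ := exists_natCast d
  · refine ⟨k, Nat.pos_of_ne_zero ?_, hk, rfl⟩
    rintro rfl
    simp [turn_zero] at h
  · rw [turn_add_half] at h
    by_cases h0 : k = 0
    · subst h0; simp [turn_zero] at h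
    · rw [turn_natCast_eq_one (Nat.pos_of_ne_zero h0) hk] at h
      exact absurd h (by decide)

theorem eq_zero_or_eq_half_of_turn_eq_zero {d : ZMod (2 * n)} (h : turn d = 0) :
    d = 0 ∨ d = n := by
  obtain ⟨k, hk, hd⟩ := exists_natCast d
  by_cases h0 : k = 0
  · subst h0; simpa using hd
  · have := turn_natCast_eq_one (Nat.pos_of_ne_zero h0) hk
    rcases hd with rfl | rfl
    · rw [this] at h; exact absurd h (by decide)
    · rw [turn_add_half, this] at h; exact absurd h (by decide)

/-- Nothing lies strictly between `x` and `y` in the cyclic order exactly if `y = x + 1`. -/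
theorem eq_add_one_iff (hn : 1 < n) (x y : ZMod (2 * n)) :
    y = x + 1 ↔ turn (y - x) = 1 ∧ ∀ z, ¬ (turn (z - x) = 1 ∧ turn (y - z) = 1) := by
  constructor
  · rintro rfl
    refine ⟨?_, ?_⟩
    · simpa using turn_natCast_eq_one (n := n) one_pos hn
    · rintro z ⟨h1, h2⟩
      obtain ⟨k, hk, hkn, hk'⟩ := exists_natCast_of_turn_eq_one h1
      obtain ⟨l, hl, hln, hl'⟩ := exists_natCast_of_turn_eq_one h2
      have : ((k + l : ℕ) : ZMod (2 * n)) = (1 : ℕ) := by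
        push_cast; rw [← hk', ← hl']; ring
      rw [ZMod.natCast_eq_natCast_iff', Nat.mod_eq_of_lt (by omega),
        Nat.mod_eq_of_lt (by omega)] at this
      omega
  · rintro ⟨h1, h2⟩
    obtain ⟨k, hk, hkn, hk'⟩ := exists_natCast_of_turn_eq_one h1
    by_cases hk1 : k = 1
    · subst hk1
      rw [← sub_add_cancel y x, hk']; push_cast; ring
    · refine absurd ⟨?_, ?_⟩ (h2 (x + 1))
      · simpa using turn_natCast_eq_one (n := n) one_pos hn
      · have := turn_natCast_eq_one (n := n) (k := k - 1) (by omega) (by omega)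
        rw [Nat.cast_sub hk, ← hk'] at this
        rw [← this]; congr 1; push_cast; ring

/-- A map preserving the cyclic orientation and antipodes is a rotation. -/
theorem exists_eq_add_of_turn_map (f : ZMod (2 * n) → ZMod (2 * n)) (hf : Function.Surjective f)
    (h : ∀ x y, turn (f y - f x) = turn (y - x)) (hhalf : ∀ x, f (x + n) = f x + n) :
    ∃ c, ∀ x, f x = x + c := by
  -- For `n > 1` the successor is definable from `turn`. For `n = 1` no `turn` equals `1`, but the
  -- successor is the antipode.
  have hsucc : ∀ x, f (x + 1) = f x + 1 := by
    intro x
    by_cases hn : 1 < n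
    · rw [eq_add_one_iff hn]
      obtain ⟨h1, h2⟩ := (eq_add_one_iff hn x (x + 1)).1 rfl
      refine ⟨by rw [h, h1], fun z hz => ?_⟩
      obtain ⟨z, rfl⟩ := hf z
      rw [h, h] at hz
      exact h2 z hz
    · have h1 : n = 1 := by have := NeZero.pos n; omega
      subst h1
      simpa using hhalf x
  have hnat : ∀ k : ℕ, f k = k + f 0 := by
    intro k
    induction k with
    | zero => simp
    | succ k ih => push_cast; rw [hsucc, ih]; ring
  refine ⟨f 0, fun x => ?_⟩
  simpa using hnat x.val

/-- Extend `σ` to all directions by commuting with antipodes. An antipode only flips the sign of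
`turn`, so the extension still preserves `turn` and is a rotation. -/
theorem Coloring.exists_rotation (b c : Coloring n) (σ : {x // b x = true} ≃ {x // c x = true})
    (h : ∀ x y, turn ((σ y).1 - (σ x).1) = turn (y.1 - x.1)) :
    ∃ d, ∀ x, c (x + d) = b x := by
  have hneg : ∀ x, ¬ b x = true → b (x + n) = true := fun x hx => by
    rw [b.add_half]; simpa using hx
  let f : ZMod (2 * n) → ZMod (2 * n) := fun x =>
    if hx : b x = true then σ ⟨x, hx⟩ else σ ⟨x + n, hneg x hx⟩ + n
  have f1 : ∀ x (hx : b x = true), f x = σ ⟨x, hx⟩ := fun x hx => dif_pos hx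
  have f2 : ∀ x (hx : ¬ b x = true), f x = σ ⟨x + n, hneg x hx⟩ + n := fun x hx => dif_neg hx
  have hc : ∀ x, c (f x) = b x := by
    intro x
    by_cases hx : b x = true
    · rw [f1 x hx, (σ _).2, hx]
    · rw [f2 x hx, c.add_half, (σ _).2]
      simpa using hx
  have hhalf : ∀ x, f (x + n) = f x + n := by
    intro x
    by_cases hx : b x = true
    · have hx' : ¬ b (x + n) = true := by rw [b.add_half, hx]; simp
      rw [f2 _ hx', f1 x hx]
      simp only [add_half_add_half]
    · rw [f1 _ (hneg x hx), f2 x hx, add_half_add_half]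
  have hinj : Function.Injective f := by
    intro x y hxy
    have hb : b x = b y := by rw [← hc, ← hc, hxy]
    by_cases hx : b x = true
    · have hy : b y = true := hb ▸ hx
      rw [f1 x hx, f1 y hy] at hxy
      exact congrArg (fun x => x.1) (σ.injective (Subtype.ext hxy))
    · have hy : ¬ b y = true := hb ▸ hx
      rw [f2 x hx, f2 y hy] at hxy
      exact add_right_cancel (congrArg (fun x => x.1) (σ.injective (Subtype.ext (add_right_cancel hxy))))
  have hturn : ∀ x y, b x = true → turn (f y - f x) = turn (y - x) := by
    intro x y hx
    by_cases hy : b y = true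
    · rw [f1 x hx, f1 y hy, h]
    · rw [f1 x hx, f2 y hy, add_sub_right_comm, turn_add_half, h, add_sub_right_comm,
        turn_add_half, neg_neg]
  obtain ⟨d, hd⟩ := exists_eq_add_of_turn_map f (Finite.surjective_of_injective hinj) (by
    intro x y
    by_cases hx : b x = true
    · exact hturn x y hx
    · have := hturn (x + n) y (hneg x hx)
      rw [hhalf, sub_add_eq_sub_sub, sub_add_eq_sub_sub, sub_eq_add_neg _ (n : ZMod (2 * n)),
        sub_eq_add_neg _ (n : ZMod (2 * n)), neg_half, turn_add_half, turn_add_half] at this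
      exact neg_injective this) hhalf
  exact ⟨d, fun x => by rw [← hd, hc]⟩

/-- A coloring without surrounding triangle consists of consecutive directions. -/
theorem Coloring.exists_eq_block (b : Coloring n)
    (h : ∀ x y z, b x = true → b y = true → b z = true →
      ¬ (turn (y - x) = 1 ∧ turn (z - y) = 1 ∧ turn (x - z) = 1)) :
    ∃ x, ∀ k : ℕ, k < n → b (x + k) = true := by
  have hn := NeZero.pos n
  -- Otherwise stepping down `n` times from a chosen direction would reach its antipode.
  have hex : ∃ x, b x = true ∧ b (x - 1) = false := by
    by_contra! hcon
    have hall : ∀ x, b x = true → ∀ k : ℕ, b (x - k) = true := by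
      intro x hx k
      induction k with
      | zero => simpa using hx
      | succ k ih =>
        have := hcon _ ih
        rw [sub_sub] at this
        push_cast
        simpa using this
    have h2 : ∀ x, b x = true → False := fun x hx => by
      have h3 := hall x hx n
      rw [sub_eq_add_neg, neg_half, b.add_half, hx] at h3
      simp at h3
    by_cases h0 : b 0 = true
    · exact h2 0 h0
    · refine h2 (0 + n) ?_
      rw [b.add_half]; simpa using h0
  obtain ⟨x, hx, hx1⟩ := hex
  refine ⟨x, fun k hk => ?_⟩
  by_contra hcon
  have hk0 : k ≠ 0 := by rintro rfl; simp [hx] at hcon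
  have e1 : b (x - 1 + n) = true := by rw [b.add_half, hx1]; rfl
  have e2 : b (x + k + n) = true := by rw [b.add_half]; simpa using hcon
  have hk1 : k ≠ n - 1 := by
    rintro rfl
    apply hcon
    rw [← e1, Nat.cast_sub hn]
    exact congrArg b.1 (by push_cast; ring)
  -- The antipodes of the missing `x - 1` and `x + k` are chosen. With `x` they leave gaps `n - 1`,
  -- `k + 1`, `n - k`, all strictly between `0` and `n`.
  refine h x (x - 1 + n) (x + k + n) hx e1 e2 ⟨?_, ?_, ?_⟩
  · rw [← turn_natCast_eq_one (n := n) (k := n - 1) (by omega) (by omega), Nat.cast_sub hn]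
    congr 1; push_cast; ring
  · rw [← turn_natCast_eq_one (n := n) (k := k + 1) (by omega) (by omega)]
    congr 1; push_cast; ring
  · rw [← turn_natCast_eq_one (n := n) (k := n - k) (by omega) (by omega), Nat.cast_sub hk.le]
    congr 1
    rw [sub_add_eq_sub_sub, sub_eq_add_neg _ (n : ZMod (2 * n)), neg_half]; ring

theorem Coloring.exists_rotation_of_acyclic (b c : Coloring n)
    (hb : ∀ x y z, b x = true → b y = true → b z = true →
      ¬ (turn (y - x) = 1 ∧ turn (z - y) = 1 ∧ turn (x - z) = 1))
    (hc : ∀ x y z, c x = true → c y = true → c z = true →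
      ¬ (turn (y - x) = 1 ∧ turn (z - y) = 1 ∧ turn (x - z) = 1)) :
    ∃ d, ∀ x, c (x + d) = b x := by
  obtain ⟨u, hu⟩ := b.exists_eq_block hb
  obtain ⟨v, hv⟩ := c.exists_eq_block hc
  refine ⟨v - u, fun x => ?_⟩
  obtain ⟨k, hk, hx | hx⟩ := exists_natCast (x - u)
  · rw [show x = u + k by rw [← hx]; ring, hu k hk, ← hv k hk]
    exact congrArg c.1 (by ring)
  · rw [show x = u + k + n by rw [add_assoc, ← hx]; ring, b.add_half, hu k hk,
      show u + k + n + (v - u) = v + k + n by ring, c.add_half, hv k hk]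

end

/-! ### The dihedral action, and codes of point sets up to this action. -/

section

variable {n : ℕ}

open DihedralGroup in
instance : MulAction (DihedralGroup (2 * n)) (Coloring n) where
  smul g b := match g with
    | r i => ⟨fun x => b (x - i), fun x => by
        rw [add_sub_right_comm, b.add_half]⟩
    | sr i => ⟨fun x => b (-x - i), fun x => by
        rw [neg_add, neg_half, add_sub_right_comm, b.add_half]⟩
  one_smul b := Coloring.ext fun x => congrArg b.1 (sub_zero x)
  mul_smul g h b := by
    rcases g with i | i <;> rcases h with j | j <;>
      refine Coloring.ext fun x => congrArg b.1 ?_ <;> ring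

theorem r_smul_apply (i : ZMod (2 * n)) (b : Coloring n) (x : ZMod (2 * n)) :
    (DihedralGroup.r i • b) x = b (x - i) := rfl

theorem sr_smul_apply (i : ZMod (2 * n)) (b : Coloring n) (x : ZMod (2 * n)) :
    (DihedralGroup.sr i • b) x = b (-x - i) := rfl

variable [NeZero n]

/-- Seen from the hub `w`, the points of `P` lie in the directions given by `b`, up to the
orientation `s`. -/
structure IsCode (b : Coloring n) (P : Finset Plane) (w : Plane) (s : SignType) : Prop where
  isHub : IsHub P w
  sign_ne_zero : s ≠ 0
  exists_equiv : ∃ e : {h // h ∈ P ∧ h ≠ w} ≃ {x // b x = true},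
    ∀ h k : {h // h ∈ P ∧ h ≠ w}, orient w h k = s * turn ((e k).1 - (e h).1)

theorem sign_mul_self {s : SignType} : s ≠ 0 → s * s = 1 := by
  revert s; decide

theorem sign_neg_ne_zero {s : SignType} : s ≠ 0 → -s ≠ 0 := by
  revert s; decide

theorem sign_eq_one_or {s : SignType} : s ≠ 0 → s = 1 ∨ s = -1 := by
  revert s; decide

theorem sign_mul_mul_cases {s t v : SignType} :
    s ≠ 0 → t ≠ 0 → v ≠ 0 → s * t * v = 1 ∨ -s * t * v = 1 := by
  revert s t v; decide

theorem sign_eq_of_mul_eq {s t v α β : SignType} :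
    s * t * v = 1 → t * α = v * (s * β) → α = β := by
  revert s t v α β; decide

theorem IsCode.sameOrderType {b : Coloring n} {P Q : Finset Plane} {w u : Plane} {s t : SignType}
    (hP : IsCode b P w s) (hQ : IsCode b Q u t) : SameOrderType P Q := by
  obtain ⟨e, he⟩ := hP.exists_equiv
  obtain ⟨f, hf⟩ := hQ.exists_equiv
  refine hP.isHub.sameOrderType hQ.isHub (e.trans f.symm) (t * s)
    (mul_ne_zero hQ.sign_ne_zero hP.sign_ne_zero) fun h k => ?_
  rw [he, hf, mul_assoc, ← mul_assoc s s, sign_mul_self hP.sign_ne_zero, one_mul]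
  simp

theorem IsCode.r_smul {b : Coloring n} {P : Finset Plane} {w : Plane} {s : SignType}
    (hP : IsCode b P w s) (i : ZMod (2 * n)) : IsCode (DihedralGroup.r i • b) P w s := by
  obtain ⟨e, he⟩ := hP.exists_equiv
  refine ⟨hP.isHub, hP.sign_ne_zero, e.trans ((Equiv.addRight i).subtypeEquiv fun x => ?_),
    fun h k => ?_⟩
  · simp [r_smul_apply]
  · rw [he]
    congr 2
    simp

theorem IsCode.sr_smul {b : Coloring n} {P : Finset Plane} {w : Plane} {s : SignType}
    (hP : IsCode b P w s) (i : ZMod (2 * n)) : IsCode (DihedralGroup.sr i • b) P w (-s) := by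
  obtain ⟨e, he⟩ := hP.exists_equiv
  refine ⟨hP.isHub, sign_neg_ne_zero hP.sign_ne_zero,
    e.trans ((Equiv.subLeft (-i)).subtypeEquiv fun x => ?_), fun h k => ?_⟩
  · simp [sr_smul_apply]
  · rw [he, neg_mul, ← mul_neg, ← turn_neg]
    congr 2
    simp

theorem IsCode.smul {b : Coloring n} {P : Finset Plane} {w : Plane} {s : SignType}
    (hP : IsCode b P w s) (g : DihedralGroup (2 * n)) : ∃ t, IsCode (g • b) P w t := by
  rcases g with i | i
  · exact ⟨s, hP.r_smul i⟩
  · exact ⟨-s, hP.sr_smul i⟩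

theorem IsCode.acyclic {b : Coloring n} {P : Finset Plane} {w : Plane} {s : SignType}
    (hP : IsCode b P w s) (hw : ¬ IsSurrounded P w) (x y z : ZMod (2 * n)) (hx : b x = true)
    (hy : b y = true) (hz : b z = true) :
    ¬ (turn (y - x) = 1 ∧ turn (z - y) = 1 ∧ turn (x - z) = 1) := by
  rintro ⟨h1, h2, h3⟩
  obtain ⟨e, he⟩ := hP.exists_equiv
  obtain ⟨p, hp⟩ := e.surjective ⟨x, hx⟩
  obtain ⟨q, hq⟩ := e.surjective ⟨y, hy⟩
  obtain ⟨r, hr⟩ := e.surjective ⟨z, hz⟩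
  have o1 : orient w p q = s := by rw [he, hp, hq, h1, mul_one]
  have o2 : orient w q r = s := by rw [he, hq, hr, h2, mul_one]
  have o3 : orient w r p = s := by rw [he, hr, hp, h3, mul_one]
  rcases sign_eq_one_or hP.sign_ne_zero with rfl | rfl
  · exact hw ⟨p, p.2.1, q, q.2.1, r, r.2.1, o1, o2, o3⟩
  · refine hw ⟨p, p.2.1, r, r.2.1, q, q.2.1, ?_, ?_, ?_⟩ <;> rw [orient_swap]
    · rw [o3, neg_neg]
    · rw [o2, neg_neg]
    · rw [o1, neg_neg]

theorem exists_smul_eq_of_equiv {b c : Coloring n} {P Q : Finset Plane} {w u : Plane}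
    {s t v : SignType} (hP : IsCode b P w s) (hQ : IsCode c Q u t) (hv : s * t * v = 1)
    (g : {h // h ∈ P ∧ h ≠ w} ≃ {h // h ∈ Q ∧ h ≠ u})
    (hg : ∀ h k, orient u (g h) (g k) = v * orient w h k) :
    ∃ d : DihedralGroup (2 * n), d • b = c := by
  obtain ⟨e, he⟩ := hP.exists_equiv
  obtain ⟨f, hf⟩ := hQ.exists_equiv
  obtain ⟨d, hd⟩ := b.exists_rotation c (e.symm.trans (g.trans f)) (by
    intro x y
    have h1 := hg (e.symm x) (e.symm y)
    rw [he, hf, Equiv.apply_symm_apply, Equiv.apply_symm_apply] at h1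
    exact sign_eq_of_mul_eq hv h1)
  refine ⟨DihedralGroup.r d, Coloring.ext fun x => ?_⟩
  rw [r_smul_apply, ← hd, sub_add_cancel]

/-- If the bijection matches the hubs, it restricts to the remaining points and yields a rotation,
possibly after a reflection. If not, each hub corresponds to an extreme point of the other set, so
neither is surrounded and both colorings are blocks. -/
theorem IsCode.exists_smul_eq {b c : Coloring n} {P Q : Finset Plane} {w u : Plane}
    {s t : SignType} (hP : IsCode b P w s) (hQ : IsCode c Q u t) (h : SameOrderType P Q) :
    ∃ g : DihedralGroup (2 * n), g • b = c := by
  obtain ⟨F, hF⟩ := h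
  by_cases hw : (F ⟨w, hP.isHub.mem⟩ : Plane) = u
  · have hFw : F ⟨w, hP.isHub.mem⟩ = ⟨u, hQ.isHub.mem⟩ := Subtype.ext hw
    obtain ⟨v, hv, hFv⟩ : ∃ v : SignType, v ≠ 0 ∧
        ∀ a b c, orient (F a) (F b) (F c) = v * orient a b c := by
      rcases hF with hF | hF
      · exact ⟨1, by decide, fun a b c => by rw [hF, one_mul]⟩
      · exact ⟨-1, by decide, fun a b c => by rw [hF, neg_one_mul]⟩
    let g : {h // h ∈ P ∧ h ≠ w} ≃ {h // h ∈ Q ∧ h ≠ u} :=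
      { toFun := fun h => ⟨F ⟨h, h.2.1⟩, (F _).2, fun hu => h.2.2 (by
          have := F.injective (Subtype.ext (hu.trans hw.symm))
          exact congrArg (fun x => x.1) this)⟩
        invFun := fun h => ⟨F.symm ⟨h, h.2.1⟩, (F.symm _).2, fun hu => h.2.2 (by
          have h1 : F.symm ⟨h, h.2.1⟩ = ⟨w, hP.isHub.mem⟩ := Subtype.ext hu
          rw [Equiv.symm_apply_eq, hFw] at h1
          exact congrArg (fun x => x.1) h1)⟩
        left_inv := fun h => by simp
        right_inv := fun h => by simp }
    have hg : ∀ h k, orient u (g h) (g k) = v * orient w h k := by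
      intro h k
      have := hFv ⟨w, hP.isHub.mem⟩ ⟨h, h.2.1⟩ ⟨k, k.2.1⟩
      rw [hw] at this
      exact this
    rcases sign_mul_mul_cases hP.sign_ne_zero hQ.sign_ne_zero hv with h1 | h1
    · exact exists_smul_eq_of_equiv hP hQ h1 g hg
    -- The signs disagree. Reflecting the code of `P` first flips `s`.
    · obtain ⟨d, hd⟩ := exists_smul_eq_of_equiv (hP.sr_smul 0) hQ h1 g hg
      exact ⟨d * DihedralGroup.sr 0, by rw [mul_smul, hd]⟩
  · have hPw : ¬ IsSurrounded P w := fun h =>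
      (hQ.isHub.isHullVertex _ (F ⟨w, hP.isHub.mem⟩).2 hw).not_isSurrounded
        (isSurrounded_of_orient_map F ⟨w, hP.isHub.mem⟩ hF h)
    have hQu : ¬ IsSurrounded Q u := fun h => by
      refine (hP.isHub.isHullVertex _ (F.symm ⟨u, hQ.isHub.mem⟩).2 fun hu => ?_).not_isSurrounded
        (isSurrounded_of_orient_map F.symm ⟨u, hQ.isHub.mem⟩ ?_ h)
      · have h1 : F.symm ⟨u, hQ.isHub.mem⟩ = ⟨w, hP.isHub.mem⟩ := Subtype.ext hu
        rw [Equiv.symm_apply_eq] at h1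
        exact hw (congrArg (fun x => x.1) h1).symm
      · rcases hF with hF | hF
        · left; intro a b c
          rw [← hF]; simp
        · right; intro a b c
          rw [← neg_neg (orient _ _ _), ← hF]; simp
    obtain ⟨d, hd⟩ := b.exists_rotation_of_acyclic c (hP.acyclic hPw) (hQ.acyclic hQu)
    refine ⟨DihedralGroup.r d, Coloring.ext fun x => ?_⟩
    rw [r_smul_apply, ← hd, sub_add_cancel]

end

/-! ### Every coloring is realised by a circle with its center. -/

section

variable {n : ℕ}

theorem Coloring.card_eq [NeZero n] (b : Coloring n) : Fintype.card {x // b x = true} = n := by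
  have h1 : Fintype.card {x // b x = true} = Fintype.card {x // ¬ b x = true} :=
    Fintype.card_congr ((Equiv.addRight (n : ZMod (2 * n))).subtypeEquiv fun x => by
      simp [b.add_half])
  have h2 := Fintype.card_subtype_compl (fun x : ZMod (2 * n) => b x = true)
  have h3 := Fintype.card_subtype_le (fun x : ZMod (2 * n) => b x = true)
  rw [ZMod.card] at h2 h3
  omega

section Wheel

variable [NeZero n]

/-- The point on the unit circle in direction `x`. -/
noncomputable def circlePoint (x : ZMod (2 * n)) : Plane :=
  !₂[(ZMod.toCircle x : ℂ).re, (ZMod.toCircle x : ℂ).im]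

theorem circlePoint_injective : Function.Injective (circlePoint (n := n)) := by
  intro x y h
  apply ZMod.injective_toCircle
  have h0 := congrFun (congrArg (fun v : Plane => v.ofLp) h) 0
  have h1 := congrFun (congrArg (fun v : Plane => v.ofLp) h) 1
  simp only [circlePoint] at h0 h1
  exact Circle.ext (Complex.ext (by simpa using h0) (by simpa using h1))

theorem norm_circlePoint (x : ZMod (2 * n)) : ‖circlePoint x‖ = 1 := by
  have h := Circle.normSq_coe (ZMod.toCircle x)
  rw [Complex.normSq_apply] at h
  rw [EuclideanSpace.norm_eq, Real.sqrt_eq_one]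
  simp only [circlePoint, Fin.sum_univ_two, Real.norm_eq_abs, sq_abs]
  simpa [sq] using h

theorem circlePoint_ne_zero (x : ZMod (2 * n)) : circlePoint x ≠ 0 := by
  rw [← norm_ne_zero_iff, norm_circlePoint]
  exact one_ne_zero

theorem orient_zero_circlePoint (x y : ZMod (2 * n)) :
    orient 0 (circlePoint x) (circlePoint y) = turn (y - x) := by
  rw [orient_eq_sign_det, turn, AddChar.map_sub_eq_div, Circle.coe_div, Complex.div_im,
    Circle.normSq_coe]
  congr 1
  simp [det, circlePoint]
  ring

/-- The center of the unit circle together with the points in the directions given by `b`. -/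
noncomputable def Coloring.wheel (b : Coloring n) : Finset Plane :=
  open Classical in
  insert 0 ((Finset.univ.filter fun x => b x = true).image circlePoint)

theorem Coloring.mem_wheel {b : Coloring n} {p : Plane} :
    p ∈ b.wheel ↔ p = 0 ∨ ∃ x, b x = true ∧ circlePoint x = p := by
  simp [wheel]

theorem Coloring.orient_zero_ne_zero (b : Coloring n) {x y : ZMod (2 * n)} (hx : b x = true)
    (hy : b y = true) (hxy : x ≠ y) : orient 0 (circlePoint x) (circlePoint y) ≠ 0 := by
  rw [orient_zero_circlePoint]
  intro h
  rcases eq_zero_or_eq_half_of_turn_eq_zero h with h | h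
  · exact hxy (sub_eq_zero.1 h).symm
  · rw [sub_eq_iff_eq_add'] at h
    rw [h, b.add_half, hx] at hy
    exact absurd hy (by decide)

theorem orient_circlePoint_ne_zero {x y z : ZMod (2 * n)} (hxy : x ≠ y) (hxz : x ≠ z)
    (hyz : y ≠ z) : orient (circlePoint x) (circlePoint y) (circlePoint z) ≠ 0 := by
  rw [Ne, ← collinear_iff_orient_eq_zero (circlePoint_injective.ne hxy),
    ← affineIndependent_iff_not_collinear_set]
  refine EuclideanGeometry.Cospherical.affineIndependent_of_ne ⟨0, 1, ?_⟩
    (circlePoint_injective.ne hxy) (circlePoint_injective.ne hxz) (circlePoint_injective.ne hyz)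
  rintro p (rfl | rfl | rfl) <;> rw [dist_zero_right, norm_circlePoint]

theorem Coloring.isHub_wheel (b : Coloring n) : IsHub b.wheel 0 := by
  refine ⟨mem_wheel.2 (Or.inl rfl), ?_, ?_⟩
  · intro p hp q hq r hr hpq hpr hqr
    rw [collinear_iff_orient_eq_zero hpq]
    rw [mem_wheel] at hp hq hr
    rcases hp with rfl | ⟨x, hx, rfl⟩
    · rcases hq with rfl | ⟨y, hy, rfl⟩
      · exact absurd rfl hpq
      rcases hr with rfl | ⟨z, hz, rfl⟩
      · exact absurd rfl hpr
      exact b.orient_zero_ne_zero hy hz fun h => hqr (h ▸ rfl)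
    rcases hq with rfl | ⟨y, hy, rfl⟩
    · rcases hr with rfl | ⟨z, hz, rfl⟩
      · exact absurd rfl hqr
      rw [← orient_rotate]
      exact b.orient_zero_ne_zero hz hx fun h => hpr (h ▸ rfl)
    rcases hr with rfl | ⟨z, hz, rfl⟩
    · rw [← orient_rotate, ← orient_rotate]
      exact b.orient_zero_ne_zero hx hy fun h => hpq (h ▸ rfl)
    exact orient_circlePoint_ne_zero (fun h => hpq (h ▸ rfl)) (fun h => hpr (h ▸ rfl))
      (fun h => hqr (h ▸ rfl))
  · intro p hp hp0
    obtain ⟨x, hx, rfl⟩ := (mem_wheel.1 hp).resolve_left hp0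
    have hsub : convexHull ℝ (b.wheel : Set Plane) ⊆ Metric.closedBall 0 1 := by
      refine convexHull_min ?_ (convex_closedBall _ _)
      intro q hq
      rcases mem_wheel.1 hq with rfl | ⟨y, -, rfl⟩
      · simp
      · rw [mem_closedBall_zero_iff, norm_circlePoint]
    -- The hull lies in the unit disc, whose boundary points are extreme by strict convexity.
    refine inter_extremePoints_subset_extremePoints_of_subset hsub
      ⟨subset_convexHull ℝ _ hp,
        StrictConvexSpace.sphere_subset_extremePoints_closedBall 0 one_ne_zero ?_⟩
    rw [mem_sphere_zero_iff_norm, norm_circlePoint]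

theorem Coloring.isCode_wheel (b : Coloring n) : IsCode b b.wheel 0 1 := by
  refine ⟨b.isHub_wheel, by decide, ?_⟩
  let f : {x // b x = true} → {h // h ∈ b.wheel ∧ h ≠ 0} := fun x =>
    ⟨circlePoint x.1, mem_wheel.2 (Or.inr ⟨x.1, x.2, rfl⟩), circlePoint_ne_zero _⟩
  have hf : Function.Bijective f := by
    constructor
    · intro x y h
      exact Subtype.ext (circlePoint_injective (congrArg (fun v => v.1) h))
    · rintro ⟨p, hp, hp0⟩
      obtain ⟨x, hx, rfl⟩ := (mem_wheel.1 hp).resolve_left hp0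
      exact ⟨⟨x, hx⟩, rfl⟩
  refine ⟨(Equiv.ofBijective f hf).symm, fun h k => ?_⟩
  obtain ⟨x, rfl⟩ := (Equiv.ofBijective f hf).surjective h
  obtain ⟨y, rfl⟩ := (Equiv.ofBijective f hf).surjective k
  rw [Equiv.symm_apply_apply, Equiv.symm_apply_apply, one_mul]
  exact orient_zero_circlePoint _ _

theorem Coloring.card_wheel (b : Coloring n) : b.wheel.card = n + 1 := by
  classical
  rw [wheel, Finset.card_insert_of_notMem, Finset.card_image_of_injective _ circlePoint_injective,
    ← Fintype.card_subtype, b.card_eq]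
  simp only [Finset.mem_image, not_exists, not_and]
  exact fun x _ => circlePoint_ne_zero x

end Wheel

/-! ### Every conowheel set has a code. -/

section Slope

/-- A key that sorts the lines through `w` by their direction. -/
noncomputable def slopeKey (w h : Plane) : ℕ ×ₗ ℝ :=
  -- For line angles in `(0, π)`, `-cot` is increasing. The horizontal line comes first, and there
  -- division by zero gives `0`, so its points share one key.
  toLex (if h 1 - w 1 = 0 then 0 else 1, -((h 0 - w 0) / (h 1 - w 1)))

/-- Whether `h` lies in the closed upper half-plane at `w`, without its left boundary ray. -/
noncomputable def upperSign (w h : Plane) : SignType :=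
  if h 1 - w 1 = 0 then SignType.sign (h 0 - w 0) else SignType.sign (h 1 - w 1)

theorem upperSign_ne_zero {w h : Plane} (hne : h ≠ w) : upperSign w h ≠ 0 := by
  unfold upperSign
  split_ifs with h1
  · rw [Ne, sign_eq_zero_iff]
    intro h0
    apply hne
    ext i; fin_cases i
    · exact sub_eq_zero.1 h0
    · exact sub_eq_zero.1 h1
  · rwa [Ne, sign_eq_zero_iff]

/-- Two upper representatives with increasing keys turn counterclockwise. Moving a point to the
opposite ray flips the sign. -/
theorem orient_eq_of_slopeKey_lt {w h k : Plane} (hlt : slopeKey w h < slopeKey w k) :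
    orient w h k = upperSign w h * upperSign w k := by
  rw [slopeKey, slopeKey, Prod.Lex.toLex_lt_toLex] at hlt
  rw [orient_eq_sign_det, det, upperSign, upperSign]
  generalize h 0 - w 0 = a at *
  generalize h 1 - w 1 = b at *
  generalize k 0 - w 0 = c at *
  generalize k 1 - w 1 = d at *
  by_cases hb : b = 0 <;> by_cases hd : d = 0
  · simp [hb, hd] at hlt
  · simp [hb, hd, sign_mul]
  · simp [hb, hd] at hlt
  · simp [hb, hd] at hlt
    rw [if_neg hb, if_neg hd, ← sign_mul]
    have : a * d - b * c = (b * d) * (a / b - c / d) := by field_simp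
    rw [this, sign_mul, sign_pos (sub_pos.2 hlt), mul_one]

theorem orient_eq_zero_of_slopeKey_eq {w h k : Plane} (heq : slopeKey w h = slopeKey w k) :
    orient w h k = 0 := by
  rw [slopeKey, slopeKey, toLex_inj, Prod.mk.injEq] at heq
  rw [orient_eq_sign_det, det, sign_eq_zero_iff]
  generalize h 0 - w 0 = a at *
  generalize h 1 - w 1 = b at *
  generalize k 0 - w 0 = c at *
  generalize k 1 - w 1 = d at *
  by_cases hb : b = 0 <;> by_cases hd : d = 0
  · simp [hb, hd]
  · simp [hb, hd] at heq
  · simp [hb, hd] at heq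
  · simp [hb, hd] at heq
    field_simp at heq
    linarith

theorem exists_equiv_fin_lt {α β : Type*} [Fintype α] [LinearOrder β] (f : α → β)
    (hf : Function.Injective f) (h : Fintype.card α = n) :
    ∃ r : α ≃ Fin n, ∀ a b, r a < r b ↔ f a < f b := by
  let _ : LinearOrder α := LinearOrder.lift' f hf
  exact ⟨(Fintype.orderIsoFinOfCardEq α h).symm.toEquiv, fun a b =>
    (Fintype.orderIsoFinOfCardEq α h).symm.lt_iff_lt⟩

variable [NeZero n]

/-- Only the ranks of the lines matter, not their angles: a point on the line of rank `r` gets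
direction `r` if it is upper and `r + n` if it is lower. -/
theorem IsHub.exists_direction {P : Finset Plane} {w : Plane} (hP : IsHub P w)
    (hcard : P.card = n + 1) :
    ∃ g : {h // h ∈ P ∧ h ≠ w} → ZMod (2 * n),
      (∀ h k : {h // h ∈ P ∧ h ≠ w}, orient w h k = turn (g k - g h)) ∧ ∀ x, (∃ h, g h = x) ∨ ∃ h, g h = x + n := by
  classical
  have hne : ∀ h k : {h // h ∈ P ∧ h ≠ w}, h ≠ k → orient w h k ≠ 0 := fun h k hhk =>
    hP.generalPosition.orient_ne_zero hP.mem h.2.1 k.2.1 h.2.2.symm k.2.2.symm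
      fun he => hhk (Subtype.ext he)
  let _ : Fintype {h // h ∈ P ∧ h ≠ w} := Fintype.subtype (P.erase w) (by simp [and_comm])
  have hcard' : Fintype.card {h // h ∈ P ∧ h ≠ w} = n := by
    rw [Fintype.card_of_subtype (P.erase w) (by simp [and_comm]), Finset.card_erase_of_mem hP.mem,
      hcard, Nat.add_sub_cancel]
  obtain ⟨r, hr⟩ := exists_equiv_fin_lt (fun h : {h // h ∈ P ∧ h ≠ w} => slopeKey w h)
    (fun h k hhk => by
      by_contra hcon
      exact hne h k hcon (orient_eq_zero_of_slopeKey_eq hhk)) hcard'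
  let g : {h // h ∈ P ∧ h ≠ w} → ZMod (2 * n) := fun h =>
    ((r h : ℕ) : ZMod (2 * n)) + if upperSign w h = 1 then 0 else (n : ZMod (2 * n))
  have hg : ∀ h : {h // h ∈ P ∧ h ≠ w}, (upperSign w h = 1 ∧ g h = ((r h : ℕ) : ZMod (2 * n))) ∨
      (upperSign w h = -1 ∧ g h = ((r h : ℕ) : ZMod (2 * n)) + n) := by
    intro h
    rcases sign_eq_one_or (upperSign_ne_zero h.2.2) with h1 | h1
    · exact Or.inl ⟨h1, by simp [g, h1]⟩
    · exact Or.inr ⟨h1, by simp [g, h1]⟩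
  have hlt : ∀ h k : {h // h ∈ P ∧ h ≠ w}, r h < r k → orient w h k = turn (g k - g h) := by
    intro h k hhk
    have ht : turn (((r k : ℕ) : ZMod (2 * n)) - ((r h : ℕ) : ZMod (2 * n))) = 1 := by
      rw [← Nat.cast_sub (le_of_lt hhk)]
      exact turn_natCast_eq_one (Nat.sub_pos_of_lt hhk) (by omega)
    rw [orient_eq_of_slopeKey_lt ((hr h k).1 hhk)]
    rcases hg h with ⟨h1, h2⟩ | ⟨h1, h2⟩ <;> rcases hg k with ⟨h3, h4⟩ | ⟨h3, h4⟩ <;>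
      rw [h1, h2, h3, h4]
    · rw [ht]; decide
    · rw [add_sub_right_comm, turn_add_half, ht]; decide
    · rw [sub_add_eq_sub_sub, sub_eq_add_neg _ (n : ZMod (2 * n)), neg_half, turn_add_half, ht]
      decide
    · rw [add_sub_add_right_eq_sub, ht]; decide
  refine ⟨g, ?_, ?_⟩
  · intro h k
    rcases lt_trichotomy (r h) (r k) with hhk | hhk | hhk
    · exact hlt h k hhk
    · rw [r.injective hhk, orient_self_right, sub_self, turn_zero]
    · rw [orient_swap, hlt k h hhk, turn_sub_comm, neg_neg]
  · intro x
    obtain ⟨k, hk, hx⟩ := exists_natCast x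
    have h1 := hg (r.symm ⟨k, hk⟩)
    rw [Equiv.apply_symm_apply] at h1
    rcases h1 with ⟨-, h1⟩ | ⟨-, h1⟩ <;> rcases hx with rfl | rfl
    · exact Or.inl ⟨_, h1⟩
    · exact Or.inr ⟨_, by rw [h1, add_half_add_half]⟩
    · exact Or.inr ⟨_, h1⟩
    · exact Or.inl ⟨_, h1⟩

theorem IsHub.exists_isCode {P : Finset Plane} {w : Plane} (hP : IsHub P w)
    (hcard : P.card = n + 1) : ∃ b : Coloring n, IsCode b P w 1 := by
  classical
  obtain ⟨g, hg, hex⟩ := hP.exists_direction hcard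
  have hinj : ∀ h k, turn (g k - g h) = 0 → h = k := by
    intro h k h0
    by_contra hcon
    rw [← hg] at h0
    exact hP.generalPosition.orient_ne_zero hP.mem h.2.1 k.2.1 h.2.2.symm k.2.2.symm
      (fun he => hcon (Subtype.ext he)) h0
  let b : Coloring n :=
    { toFun := fun x => decide (∃ h, g h = x)
      map_add_half := by
        intro x
        have hnot : (∃ h, g h = x) → ¬ ∃ h, g h = x + n := by
          rintro ⟨h, hh⟩ ⟨k, hk⟩
          have hhk : h = k := hinj h k (by rw [hh, hk, add_sub_cancel_left, turn_half])
          rw [hhk, hk] at hh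
          exact half_ne_zero (add_eq_left.1 hh)
        by_cases hx : ∃ h, g h = x
        · rw [decide_eq_true hx, decide_eq_false (hnot hx)]; rfl
        · rw [decide_eq_false hx, decide_eq_true ((hex x).resolve_left hx)]; rfl }
  have hb : ∀ x, b x = true ↔ ∃ h, g h = x := fun x => decide_eq_true_iff
  let f : {h // h ∈ P ∧ h ≠ w} → {x // b x = true} := fun h => ⟨g h, (hb _).2 ⟨h, rfl⟩⟩
  have hf : Function.Bijective f := by
    constructor
    · intro h k hhk
      refine hinj h k ?_
      rw [show g k = g h from congrArg (fun x => x.1) hhk.symm, sub_self, turn_zero]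
    · rintro ⟨x, hx⟩
      obtain ⟨h, rfl⟩ := (hb x).1 hx
      exact ⟨h, rfl⟩
  exact ⟨b, hP, by decide, Equiv.ofBijective f hf, fun h k => by rw [one_mul, hg]; rfl⟩

/-- Order types of conowheel sets correspond to colorings up to rotation and reflection. -/
theorem nonempty_orbits_equiv_orderType (n : ℕ) [NeZero n] :
    Nonempty (MulAction.orbitRel.Quotient (DihedralGroup (2 * n)) (Coloring n) ≃
      OrderType (n + 1)) := by
  let F : Coloring n → ConowheelSetOfSize (n + 1) := fun b =>
    ⟨b.wheel, b.isHub_wheel.isConowheelSet, b.card_wheel⟩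
  have hF : ∀ b c : Coloring n, MulAction.orbitRel (DihedralGroup (2 * n)) (Coloring n) b c ↔
      orderTypeSetoid (n + 1) (F b) (F c) := by
    intro b c
    rw [MulAction.orbitRel_apply, MulAction.mem_orbit_iff]
    constructor
    · rintro ⟨g, rfl⟩
      obtain ⟨t, ht⟩ := c.isCode_wheel.smul g
      exact (g • c).isCode_wheel.sameOrderType ht
    · intro h
      exact c.isCode_wheel.exists_smul_eq b.isCode_wheel (SameOrderType.symm h)
  refine ⟨Equiv.ofBijective (Quotient.map F fun b c h => (hF b c).1 h) ⟨?_, ?_⟩⟩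
  · rintro ⟨b⟩ ⟨c⟩ h
    exact Quotient.sound ((hF b c).2 (Quotient.exact h))
  · rintro ⟨P, hP, hcard⟩
    obtain ⟨w, hw⟩ := hP.exists_isHub (Finset.card_pos.1 (by omega))
    obtain ⟨b, hb⟩ := hw.exists_isCode hcard
    exact ⟨Quotient.mk _ b, Quotient.sound (b.isCode_wheel.sameOrderType hb)⟩

end Slope

end

/-! ### Colorings fixed by a rotation or a reflection. -/

section

variable {n : ℕ}

theorem Coloring.add_natCast_mul {b : Coloring n} {m : ℕ} (h : ∀ x, b (x + m) = !b x) (q : ℕ)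
    (x : ZMod (2 * n)) : b (x + (q * m : ℕ)) = (b x ^^ q.bodd) := by
  induction q with
  | zero => simp
  | succ q ih =>
    rw [Nat.succ_mul q m, Nat.cast_add, ← add_assoc, h, ih, Nat.bodd_succ]
    cases b x <;> cases q.bodd <;> rfl

theorem apply_add_mul_of_antiperiodic {G : ℕ → Bool} {m : ℕ} (h : ∀ a, G (a + m) = !G a) (q a : ℕ) :
    G (a + q * m) = (G a ^^ q.bodd) := by
  induction q with
  | zero => simp
  | succ q ih =>
    rw [Nat.succ_mul, ← add_assoc, h, ih, Nat.bodd_succ]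
    cases G a <;> cases q.bodd <;> rfl

/-- Extend `f` antiperiodically from `{0, …, m - 1}` to the natural numbers. -/
def antiperiodicExtend (m : ℕ) (f : ℕ → Bool) (a : ℕ) : Bool := f (a % m) ^^ (a / m).bodd

theorem antiperiodicExtend_add {m : ℕ} (hm : 0 < m) (f : ℕ → Bool) (a : ℕ) :
    antiperiodicExtend m f (a + m) = !antiperiodicExtend m f a := by
  rw [antiperiodicExtend, antiperiodicExtend, Nat.add_mod_right, Nat.add_div_right _ hm,
    Nat.bodd_succ, Bool.xor_not]

theorem antiperiodicExtend_of_lt {m a : ℕ} (f : ℕ → Bool) (h : a < m) :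
    antiperiodicExtend m f a = f a := by
  rw [antiperiodicExtend, Nat.mod_eq_of_lt h, Nat.div_eq_of_lt h, Nat.bodd_zero, Bool.xor_false]

instance : Finite (Coloring n) := by
  rcases Nat.eq_zero_or_pos n with rfl | hn
  · have : IsEmpty (Coloring 0) := ⟨fun b => by
      have := b.add_half 0
      simp at this⟩
    infer_instance
  · have : NeZero n := ⟨hn.ne'⟩
    exact Finite.of_injective _ Coloring.toFun_injective

open DihedralGroup MulAction

/-- This reflection swaps `-t` with its antipode, where a coloring takes the other value. -/
theorem card_fixedBy_sr_of_even (i t : ZMod (2 * n)) (hi : i + n = 2 * t) :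
    Nat.card (fixedBy (Coloring n) (sr i)) = 0 := by
  rw [Nat.card_eq_zero]
  left
  refine ⟨fun ⟨b, hb⟩ => ?_⟩
  rw [mem_fixedBy] at hb
  have h1 : (sr i • b) (-t) = b (-t) := by rw [hb]
  rw [sr_smul_apply, show -(-t) - i = -t + n by linear_combination -hi,
    b.add_half] at h1
  simp at h1

variable [NeZero n]

/-- The coloring with values `G 0, G 1, …`. -/
def Coloring.ofNat (G : ℕ → Bool) (hG : ∀ a, G (a + n) = !G a) : Coloring n where
  toFun x := G x.val
  map_add_half x := by
    rw [← hG, ZMod.val_add, val_half]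
    conv_rhs => rw [← Nat.mod_add_div (x.val + n) (2 * n)]
    rw [show 2 * n * ((x.val + n) / (2 * n)) = (2 * ((x.val + n) / (2 * n))) * n by ring,
      apply_add_mul_of_antiperiodic hG]
    simp

theorem Coloring.ofNat_natCast (G : ℕ → Bool) (hG : ∀ a, G (a + n) = !G a) (a : ℕ) :
    Coloring.ofNat G hG (a : ZMod (2 * n)) = G a := by
  change G (a : ZMod (2 * n)).val = G a
  rw [ZMod.val_natCast]
  conv_rhs => rw [← Nat.mod_add_div a (2 * n)]
  rw [show 2 * n * (a / (2 * n)) = (2 * (a / (2 * n))) * n by ring, apply_add_mul_of_antiperiodic hG]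
  simp

theorem Coloring.ext_natCast {b c : Coloring n} (h : ∀ k : ℕ, k < n → b (k : ZMod (2 * n)) = c k) :
    b = c := by
  refine Coloring.ext fun x => ?_
  obtain ⟨k, hk, rfl | rfl⟩ := exists_natCast x
  · exact h k hk
  · rw [b.add_half, c.add_half, h k hk]

/-- The colorings that are antiperiodic with period `m`. -/
theorem card_antiperiodic {m k : ℕ} (hmk : n = m * k) (hk : Odd k) :
    Nat.card {b : Coloring n // ∀ x, b (x + m) = !b x} = 2 ^ m := by
  have hn := NeZero.pos n
  have hm : 0 < m := Nat.pos_of_ne_zero fun h => by subst h; omega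
  have hmn : m ≤ n := hmk ▸ Nat.le_mul_of_pos_right m hk.pos
  let ext : (Fin m → Bool) → ℕ → Bool := fun f a => if h : a < m then f ⟨a, h⟩ else false
  -- As `n` is an odd multiple of `m`, antiperiod `m` implies antiperiod `n`, so the first `m`
  -- values are free.
  have hG : ∀ f a, antiperiodicExtend m (ext f) (a + n) = !antiperiodicExtend m (ext f) a := by
    intro f a
    rw [hmk, mul_comm, apply_add_mul_of_antiperiodic (antiperiodicExtend_add hm _)]
    obtain ⟨j, rfl⟩ := hk
    rw [show (2 * j + 1).bodd = true by rw [Nat.bodd_add, Nat.bodd_mul]; rfl, Bool.xor_true]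
  have heq : {b : Coloring n // ∀ x, b (x + m) = !b x} ≃ (Fin m → Bool) :=
    { toFun := fun b j => b.1 ((j : ℕ) : ZMod (2 * n))
      invFun := fun f => ⟨Coloring.ofNat (antiperiodicExtend m (ext f)) (hG f), fun x => by
        have hx : x = (x.val : ZMod (2 * n)) := by simp
        rw [hx, ← Nat.cast_add, Coloring.ofNat_natCast, Coloring.ofNat_natCast,
          antiperiodicExtend_add hm]⟩
      left_inv := fun b => by
        refine Subtype.ext (Coloring.ext_natCast fun a _ => ?_)
        rw [Coloring.ofNat_natCast, antiperiodicExtend]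
        simp only [ext, dif_pos (Nat.mod_lt a hm)]
        rw [← Coloring.add_natCast_mul b.2, ← Nat.cast_add, Nat.mod_add_div']
      right_inv := fun f => by
        funext j
        simp only [Coloring.ofNat_natCast]
        rw [antiperiodicExtend_of_lt _ j.2]
        simp [ext] }
  rw [Nat.card_congr heq]
  simp

/-- Since `-k - 1 = (n - 1 - k) + n`, the condition says that the values at `0, …, n - 1` form a
palindrome, determined by its first `⌈n/2⌉` entries. -/
theorem card_palindromic :
    Nat.card {b : Coloring n // ∀ x, b (-x - 1) = !b x} = 2 ^ ((n + 1) / 2) := by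
  have hn := NeZero.pos n
  have hrefl : ∀ k < n, -((k : ℕ) : ZMod (2 * n)) - 1 = ((n - 1 - k : ℕ) : ZMod (2 * n)) + n := by
    intro k hk
    rw [Nat.cast_sub (by omega), Nat.cast_sub hn, eq_comm, ← sub_eq_zero,
      ← half_add_half (n := n)]
    push_cast
    ring
  let ext : (Fin ((n + 1) / 2) → Bool) → ℕ → Bool := fun f a =>
    if h : min a (n - 1 - a) < (n + 1) / 2 then f ⟨min a (n - 1 - a), h⟩ else false
  have hrev : ∀ f, ∀ a < n, ext f (n - 1 - a) = ext f a := by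
    intro f a ha
    have : min (n - 1 - a) (n - 1 - (n - 1 - a)) = min a (n - 1 - a) := by omega
    simp only [ext, this]
  have heq : {b : Coloring n // ∀ x, b (-x - 1) = !b x} ≃ (Fin ((n + 1) / 2) → Bool) :=
    { toFun := fun b j => b.1 ((j : ℕ) : ZMod (2 * n))
      invFun := fun f => ⟨Coloring.ofNat (antiperiodicExtend n (ext f))
          (antiperiodicExtend_add hn _), by
        have key : ∀ k < n, Coloring.ofNat (antiperiodicExtend n (ext f))
            (antiperiodicExtend_add hn _) (-((k : ℕ) : ZMod (2 * n)) - 1) =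
            !Coloring.ofNat (antiperiodicExtend n (ext f)) (antiperiodicExtend_add hn _)
              ((k : ℕ) : ZMod (2 * n)) := by
          intro k hk
          rw [hrefl k hk, Coloring.add_half, Coloring.ofNat_natCast, Coloring.ofNat_natCast,
            antiperiodicExtend_of_lt _ hk, antiperiodicExtend_of_lt _ (by omega), hrev f k hk]
        intro x
        obtain ⟨k, hk, rfl | rfl⟩ := exists_natCast x
        · exact key k hk
        · rw [neg_add, neg_half, add_sub_right_comm, Coloring.add_half, Coloring.add_half,
            key k hk]⟩
      left_inv := fun b => by
        refine Subtype.ext (Coloring.ext_natCast fun a ha => ?_)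
        rw [Coloring.ofNat_natCast, antiperiodicExtend_of_lt _ ha]
        have hlt : min a (n - 1 - a) < (n + 1) / 2 := by omega
        simp only [ext, dif_pos hlt]
        rcases le_total a (n - 1 - a) with h | h
        · rw [min_eq_left h]
        · rw [min_eq_right h]
          have h1 := b.2 ((a : ℕ) : ZMod (2 * n))
          rw [hrefl a ha, Coloring.add_half] at h1
          simpa using h1
      right_inv := fun f => by
        funext j
        have hj := j.2
        simp only [Coloring.ofNat_natCast]
        rw [antiperiodicExtend_of_lt _ (by omega)]
        have hmin : min (j : ℕ) (n - 1 - j) = j := by omega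
        simp [ext, hmin] }
  rw [Nat.card_congr heq]
  simp

/-- Write `n = k * m` with `k` the order of `i`. Then `i` and `2 * m` generate the same subgroup, so
being fixed means having period `2 * m`. As `n` is an odd multiple of `m`, this amounts to
antiperiod `m`. -/
theorem card_fixedBy_r_of_odd (i : ZMod (2 * n)) (hi : Odd (addOrderOf i)) :
    Nat.card (fixedBy (Coloring n) (r i)) = 2 ^ (n / addOrderOf i) := by
  have hn := NeZero.pos n
  have hdvd : addOrderOf i ∣ n := by
    have h1 : addOrderOf i ∣ 2 * n := by
      have := addOrderOf_dvd_card (x := i)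
      rwa [ZMod.card] at this
    exact (Nat.Coprime.dvd_mul_left (Nat.coprime_two_right.2 hi)).1 h1
  obtain ⟨m, hm⟩ := hdvd
  set k := addOrderOf i with hk
  have hkpos : 0 < k := hi.pos
  have hmpos : 0 < m := Nat.pos_of_ne_zero fun h => by subst h; omega
  have hdiv : n / k = m := by rw [hm, Nat.mul_div_cancel_left _ hkpos]
  have horder : addOrderOf ((2 * m : ℕ) : ZMod (2 * n)) = k := by
    rw [ZMod.addOrderOf_coe _ (by omega), hm, show 2 * (k * m) = k * (2 * m) by ring,
      Nat.gcd_mul_left_left, Nat.mul_div_cancel _ (by omega)]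
  have hle : AddSubgroup.zmultiples i ≤ AddSubgroup.zmultiples ((2 * m : ℕ) : ZMod (2 * n)) := by
    rw [AddSubgroup.zmultiples_le]
    have h0 : k • i = 0 := addOrderOf_nsmul_eq_zero i
    rw [← ZMod.natCast_zmod_val i, nsmul_eq_mul, ← Nat.cast_mul, ZMod.natCast_eq_zero_iff] at h0
    have h2n : 2 * n = k * (2 * m) := by rw [hm]; ring
    obtain ⟨q, hq⟩ := Nat.dvd_of_mul_dvd_mul_left hkpos ((dvd_of_eq h2n.symm).trans h0)
    rw [AddSubgroup.mem_zmultiples_iff]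
    refine ⟨q, ?_⟩
    rw [← ZMod.natCast_zmod_val i, hq]
    push_cast
    simp [mul_comm]
  have heq : AddSubgroup.zmultiples i = AddSubgroup.zmultiples ((2 * m : ℕ) : ZMod (2 * n)) := by
    refine AddSubgroup.eq_of_le_of_card_ge hle ?_
    rw [Nat.card_zmultiples, Nat.card_zmultiples, horder]
  have hperiod : ∀ (b : Coloring n) (u v : ZMod (2 * n)), v ∈ AddSubgroup.zmultiples u →
      (∀ x, b (x - u) = b x) → ∀ x, b (x + v) = b x := by
    intro b u v hv hu
    have hu' : ∀ x, b (x + u) = b x := fun x => by rw [← hu (x + u), add_sub_cancel_right]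
    obtain ⟨q, rfl⟩ := mem_multiples_iff_mem_zmultiples.2 hv
    induction q with
    | zero => simp
    | succ q ih =>
      intro x
      simp only [succ_nsmul, ← add_assoc, hu']
      exact ih (AddSubgroup.nsmul_mem_zmultiples u q) x
  rw [hdiv, ← card_antiperiodic (n := n) (m := m) (k := k) (by rw [hm, mul_comm]) hi]
  refine Nat.card_congr (Equiv.subtypeEquivRight fun b => ?_)
  rw [mem_fixedBy]
  have hfix : r i • b = b ↔ ∀ x, b (x - i) = b x :=
    ⟨fun h x => by rw [← r_smul_apply, h], fun h => Coloring.ext fun x => h x⟩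
  rw [hfix]
  obtain ⟨j, hj⟩ := hi
  constructor
  · intro h x
    have h2 := hperiod b i _ (heq.symm ▸ AddSubgroup.mem_zmultiples ((2 * m : ℕ) : ZMod (2 * n))) h
    have h3 : ∀ q : ℕ, ∀ x, b (x + (q * (2 * m) : ℕ)) = b x := by
      intro q
      induction q with
      | zero => simp
      | succ q ih =>
        intro x
        rw [Nat.succ_mul q (2 * m), Nat.cast_add, ← add_assoc, h2, ih]
    rw [← b.add_half, ← h3 j (x + m)]
    refine congrArg b.1 ?_
    have : (n : ZMod (2 * n)) = ((k * m : ℕ) : ZMod (2 * n)) := congrArg _ hm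
    rw [this, hj]
    push_cast
    ring
  · intro h
    have h2 : ∀ x, b (x - (2 * m : ℕ)) = b x := by
      intro x
      rw [← sub_add_cancel x ((2 * m : ℕ) : ZMod (2 * n)), Coloring.add_natCast_mul h]
      simp
    have h3 := hperiod b _ i (heq ▸ AddSubgroup.mem_zmultiples _) h2
    intro x
    rw [← h3 (x - i), sub_add_cancel]

/-- Some multiple of `i` has order two, hence is `n`, and translation by `n` negates every coloring.
-/
theorem card_fixedBy_r_of_even (i : ZMod (2 * n)) (hi : Even (addOrderOf i)) :
    Nat.card (fixedBy (Coloring n) (r i)) = 0 := by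
  rw [Nat.card_eq_zero]
  left
  refine ⟨fun ⟨b, hb⟩ => ?_⟩
  rw [mem_fixedBy] at hb
  have hper : ∀ q : ℕ, ∀ x, b (x - q • i) = b x := by
    intro q
    induction q with
    | zero => simp
    | succ q ih =>
      intro x
      rw [succ_nsmul, sub_add_eq_sub_sub, ← r_smul_apply, hb, ih]
  obtain ⟨q, hq⟩ := hi
  have hpos := addOrderOf_pos i
  have h0 : q • i ≠ 0 := nsmul_ne_zero_of_lt_addOrderOf (by omega) (by omega)
  have h1 : q • i + q • i = 0 := by rw [← add_nsmul, ← hq, addOrderOf_nsmul_eq_zero]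
  have hk0 : ∀ k < n, ((k : ℕ) : ZMod (2 * n)) + k = 0 → k = 0 := by
    intro k hk h
    rw [← Nat.cast_add, ZMod.natCast_eq_zero_iff] at h
    have := Nat.eq_zero_of_dvd_of_lt h (by omega)
    omega
  have h2 : q • i = (n : ZMod (2 * n)) := by
    obtain ⟨k, hk, h | h⟩ := exists_natCast (q • i)
    · rw [h] at h0 h1
      rw [hk0 k hk h1, Nat.cast_zero] at h0
      exact absurd rfl h0
    · rw [h, add_add_add_comm, half_add_half, add_zero] at h1
      rw [h, hk0 k hk h1, Nat.cast_zero, zero_add]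
  have h3 := hper q 0
  rw [h2, zero_sub, neg_half, ← zero_add (n : ZMod (2 * n)), b.add_half] at h3
  simp at h3

/-- Rotating by `t` turns the fixed-point condition into the palindrome condition. -/
theorem card_fixedBy_sr_of_odd (i t : ZMod (2 * n)) (hi : i + n = 2 * t + 1) :
    Nat.card (fixedBy (Coloring n) (sr i)) = 2 ^ ((n + 1) / 2) := by
  rw [← card_palindromic]
  refine Nat.card_congr ((MulAction.toPerm (r t)).subtypeEquiv fun b => ?_)
  rw [mem_fixedBy]
  simp only [toPerm_apply, r_smul_apply]
  have key : ∀ x, (!b (-(x + t) - 1 - t)) = b (-x - i) := by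
    intro x
    rw [← b.add_half]
    exact congrArg b.1 (by linear_combination hi)
  constructor
  · intro h x
    have := key (x - t)
    rw [sub_add_cancel, ← sr_smul_apply, h] at this
    rw [← this, Bool.not_not]
  · intro h
    refine Coloring.ext fun x => ?_
    rw [sr_smul_apply, ← key, h, Bool.not_not, add_sub_cancel_right]

end

/-! ### Burnside count, closed formula and asymptotics. -/

section

open DihedralGroup MulAction

/-- Group the rotations by order: `φ(k)` of them have order `k`, and the odd divisors of `2 * n` are
those of `n`. -/
theorem sum_card_fixedBy_r (n : ℕ) [NeZero n] :
    ∑ i : ZMod (2 * n), Nat.card (fixedBy (Coloring n) (r i)) =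
      ∑ k ∈ n.divisors.filter (fun k => ¬ 2 ∣ k), Nat.totient k * 2 ^ (n / k) := by
  have hn := NeZero.pos n
  have h1 : ∀ i : ZMod (2 * n), Nat.card (fixedBy (Coloring n) (r i)) =
      if ¬ 2 ∣ addOrderOf i then 2 ^ (n / addOrderOf i) else 0 := by
    intro i
    split_ifs with h
    · exact card_fixedBy_r_of_even i (even_iff_two_dvd.2 h)
    · exact card_fixedBy_r_of_odd i (Nat.not_even_iff_odd.1 fun he => h he.two_dvd)
  rw [Finset.sum_congr rfl fun i _ => h1 i,
    ← Finset.sum_fiberwise_of_maps_to (t := (2 * n).divisors) (g := addOrderOf) (fun i _ => by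
      rw [Nat.mem_divisors]
      have := addOrderOf_dvd_card (x := i)
      rw [ZMod.card] at this
      exact ⟨this, by omega⟩)]
  have hfilter : n.divisors.filter (fun k => ¬ 2 ∣ k) =
      (2 * n).divisors.filter (fun k => ¬ 2 ∣ k) := by
    ext k
    simp only [Finset.mem_filter, Nat.mem_divisors]
    constructor
    · rintro ⟨⟨h, -⟩, h2⟩
      exact ⟨⟨h.mul_left 2, by omega⟩, h2⟩
    · rintro ⟨⟨h, -⟩, h2⟩
      refine ⟨⟨?_, by omega⟩, h2⟩
      exact (((Nat.Prime.coprime_iff_not_dvd Nat.prime_two).2 h2).symm).dvd_of_dvd_mul_left h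
  rw [hfilter, Finset.sum_filter]
  refine Finset.sum_congr rfl fun k hk => ?_
  have hcard : (Finset.univ.filter fun i : ZMod (2 * n) => addOrderOf i = k).card =
      Nat.totient k :=
    IsAddCyclic.card_addOrderOf_eq_totient (by
      rw [ZMod.card]; exact Nat.dvd_of_mem_divisors hk)
  rw [Finset.sum_congr rfl fun i hi => by rw [(Finset.mem_filter.1 hi).2], Finset.sum_const, hcard]
  split_ifs <;> simp

theorem sum_card_fixedBy_sr (n : ℕ) [NeZero n] :
    ∑ i : ZMod (2 * n), Nat.card (fixedBy (Coloring n) (sr i)) = n * 2 ^ ((n + 1) / 2) := by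
  -- Of two consecutive reflections exactly one is of the odd kind. Summing over all `i` counts each
  -- reflection twice.
  have hpair : ∀ i : ZMod (2 * n), Nat.card (fixedBy (Coloring n) (sr i)) +
      Nat.card (fixedBy (Coloring n) (sr (i + 1))) = 2 ^ ((n + 1) / 2) := by
    intro i
    have hval : (((i + n).val : ℕ) : ZMod (2 * n)) = i + n := by simp
    rcases Nat.even_or_odd' (i + n).val with ⟨t, ht | ht⟩
    · rw [ht] at hval
      push_cast at hval
      rw [card_fixedBy_sr_of_even i t hval.symm,
        card_fixedBy_sr_of_odd (i + 1) t (by linear_combination -hval), zero_add]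
    · rw [ht] at hval
      push_cast at hval
      rw [card_fixedBy_sr_of_odd i t hval.symm,
        card_fixedBy_sr_of_even (i + 1) (t + 1) (by linear_combination -hval), add_zero]
  have hshift : ∑ i : ZMod (2 * n), Nat.card (fixedBy (Coloring n) (sr (i + 1))) =
      ∑ i : ZMod (2 * n), Nat.card (fixedBy (Coloring n) (sr i)) :=
    Equiv.sum_comp (Equiv.addRight (1 : ZMod (2 * n)))
      fun i => Nat.card (fixedBy (Coloring n) (sr i))
  have hsum := Finset.sum_congr rfl fun (i : ZMod (2 * n)) (_ : i ∈ Finset.univ) => hpair i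
  rw [Finset.sum_add_distrib, hshift, Finset.sum_const, Finset.card_univ, ZMod.card,
    smul_eq_mul] at hsum
  linarith

theorem card_orbits_mul (n : ℕ) [NeZero n] :
    Nat.card (orbitRel.Quotient (DihedralGroup (2 * n)) (Coloring n)) * (4 * n) =
      ∑ k ∈ n.divisors.filter (fun k => ¬ 2 ∣ k), Nat.totient k * 2 ^ (n / k) +
        n * 2 ^ ((n + 1) / 2) := by
  classical
  let _ : Fintype (Coloring n) := Fintype.ofFinite _
  let _ : Fintype (orbitRel.Quotient (DihedralGroup (2 * n)) (Coloring n)) := Fintype.ofFinite _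
  have h := sum_card_fixedBy_eq_card_orbits_mul_card_group (DihedralGroup (2 * n)) (Coloring n)
  have hG : ∑ g : DihedralGroup (2 * n), Fintype.card (fixedBy (Coloring n) g) =
      ∑ i : ZMod (2 * n), Nat.card (fixedBy (Coloring n) (r i)) +
        ∑ i : ZMod (2 * n), Nat.card (fixedBy (Coloring n) (sr i)) := by
    rw [← Equiv.sum_comp (equivSum (n := 2 * n)).symm, Fintype.sum_sum_type]
    exact congrArg₂ (· + ·) (Finset.sum_congr rfl fun i _ => Nat.card_eq_fintype_card.symm)
      (Finset.sum_congr rfl fun i _ => Nat.card_eq_fintype_card.symm)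
  rw [hG, sum_card_fixedBy_r, sum_card_fixedBy_sr, DihedralGroup.card] at h
  rw [h, ← mul_assoc 2 2 n]
  exact congrArg (· * (2 * 2 * n)) Nat.card_eq_fintype_card

theorem card_orderType_mul (n : ℕ) [NeZero n] :
    Nat.card (OrderType (n + 1)) * (4 * n) =
      ∑ k ∈ n.divisors.filter (fun k => ¬ 2 ∣ k), Nat.totient k * 2 ^ (n / k) +
        n * 2 ^ ((n + 1) / 2) := by
  obtain ⟨e⟩ := nonempty_orbits_equiv_orderType n
  rw [← Nat.card_congr e, card_orbits_mul]

theorem card_orderType (n : ℕ) (hn : 1 ≤ n) :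
    (Nat.card (OrderType (n + 1)) : ℝ) =
      1 / (4 * (n : ℝ)) *
          ∑ k ∈ n.divisors.filter (fun k => ¬ 2 ∣ k), (Nat.totient k : ℝ) * 2 ^ (n / k)
        + (2 : ℝ) ^ ⌊((n : ℝ) - 3) / 2⌋ := by
  have : NeZero n := ⟨by omega⟩
  have hn0 : (n : ℝ) ≠ 0 := Nat.cast_ne_zero.2 (by omega)
  have h := congrArg (Nat.cast : ℕ → ℝ) (card_orderType_mul n)
  push_cast at h
  -- The `- 2` is the factor `4` of the group order. The exponent is `-1` for `n = 1, 2`, hence an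
  -- integer power.
  have hfloor : ⌊((n : ℝ) - 3) / 2⌋ = (((n + 1) / 2 : ℕ) : ℤ) - 2 := by
    have h1 : 2 * ((n + 1) / 2) ≤ n + 1 := Nat.mul_div_le _ _
    have h2 : n ≤ 2 * ((n + 1) / 2) := by omega
    have h1' : (2 : ℝ) * ((n + 1) / 2 : ℕ) ≤ n + 1 := by exact_mod_cast h1
    have h2' : (n : ℝ) ≤ 2 * ((n + 1) / 2 : ℕ) := by exact_mod_cast h2
    generalize (n + 1) / 2 = q at *
    rw [Int.floor_eq_iff, Int.cast_sub, Int.cast_natCast, Int.cast_ofNat]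
    constructor <;> linarith
  rw [hfloor, zpow_sub₀ two_ne_zero, zpow_natCast]
  generalize ∑ k ∈ n.divisors.filter (fun k => ¬ 2 ∣ k), (Nat.totient k : ℝ) * 2 ^ (n / k) = S at *
  field_simp
  linarith

/-- The term `k = 1` is `2 ^ n`. Each of the at most `n` divisors `k ≥ 2` contributes at most `n * 2
^ (n / 2)`. -/
theorem sum_totient_le (n : ℕ) :
    ∑ k ∈ n.divisors.filter (fun k => ¬ 2 ∣ k), Nat.totient k * 2 ^ (n / k) ≤
      2 ^ n + n ^ 2 * 2 ^ (n / 2) := by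
  calc ∑ k ∈ n.divisors.filter (fun k => ¬ 2 ∣ k), Nat.totient k * 2 ^ (n / k)
      ≤ ∑ k ∈ n.divisors, Nat.totient k * 2 ^ (n / k) :=
        Finset.sum_le_sum_of_subset (Finset.filter_subset _ _)
    _ ≤ ∑ k ∈ n.divisors, ((if k = 1 then 2 ^ n else 0) + n * 2 ^ (n / 2)) := by
        refine Finset.sum_le_sum fun k hk => ?_
        have hk0 : 0 < k := Nat.pos_of_mem_divisors hk
        split_ifs with h
        · subst h; simp
        · rw [zero_add]
          exact Nat.mul_le_mul ((Nat.totient_le k).trans (Nat.divisor_le hk))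
            (Nat.pow_le_pow_right two_pos (Nat.div_le_div_left (by omega) two_pos))
    _ ≤ 2 ^ n + n ^ 2 * 2 ^ (n / 2) := by
        rw [Finset.sum_add_distrib, Finset.sum_const, smul_eq_mul, sq, mul_assoc]
        refine add_le_add ?_ (Nat.mul_le_mul_right _ (Nat.card_divisors_le_self n))
        rw [Finset.sum_ite_eq']
        split_ifs <;> simp

theorem sq_le_mul_two_pow_half (n : ℕ) : n ^ 2 ≤ 16 * 2 ^ (n / 2) := by
  have h1 : n / 4 + 1 ≤ 2 ^ (n / 4) := Nat.lt_two_pow_self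
  have h2 : n ≤ 4 * 2 ^ (n / 4) := by omega
  calc n ^ 2 ≤ (4 * 2 ^ (n / 4)) ^ 2 := Nat.pow_le_pow_left h2 2
    _ = 16 * 2 ^ (n / 4 * 2) := by rw [mul_pow, ← pow_mul]; rfl
    _ ≤ 16 * 2 ^ (n / 2) := Nat.mul_le_mul_left _ (Nat.pow_le_pow_right two_pos (by omega))

/-- The constant is `49 = 1 + 16 + 32`: the main term, the other rotations, the reflections. -/
theorem card_orderType_mul_le (n : ℕ) [NeZero n] :
    Nat.card (OrderType (n + 1)) * (4 * n) ≤ 49 * 2 ^ n := by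
  have hn : n ≤ n ^ 2 := Nat.le_self_pow two_ne_zero n
  have h1 : n ^ 2 * 2 ^ (n / 2) ≤ 16 * 2 ^ n := by
    calc n ^ 2 * 2 ^ (n / 2) ≤ 16 * 2 ^ (n / 2) * 2 ^ (n / 2) :=
          Nat.mul_le_mul_right _ (sq_le_mul_two_pow_half n)
      _ = 16 * 2 ^ (n / 2 + n / 2) := by rw [mul_assoc, ← pow_add]
      _ ≤ 16 * 2 ^ n := Nat.mul_le_mul_left _ (Nat.pow_le_pow_right two_pos (by omega))
  have h2 : n * 2 ^ ((n + 1) / 2) ≤ 2 * (n ^ 2 * 2 ^ (n / 2)) := by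
    calc n * 2 ^ ((n + 1) / 2) ≤ n ^ 2 * 2 ^ (n / 2 + 1) :=
          Nat.mul_le_mul hn (Nat.pow_le_pow_right two_pos (by omega))
      _ = 2 * (n ^ 2 * 2 ^ (n / 2)) := by rw [pow_succ]; ring
  rw [card_orderType_mul]
  have h3 := sum_totient_le n
  omega

theorem two_pow_le_card_orderType_mul (n : ℕ) [NeZero n] :
    2 ^ n ≤ Nat.card (OrderType (n + 1)) * (4 * n) := by
  rw [card_orderType_mul]
  refine le_add_right ?_
  have h1 : 1 ∈ n.divisors.filter (fun k => ¬ 2 ∣ k) := by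
    simp [NeZero.ne n]
  simpa using Finset.single_le_sum (f := fun k => Nat.totient k * 2 ^ (n / k))
    (fun _ _ => Nat.zero_le _) h1

theorem card_orderType_isTheta :
    (fun n : ℕ => (Nat.card (OrderType (n + 1)) : ℝ))
      =Θ[Filter.atTop] (fun n : ℕ => (2 : ℝ) ^ n / (n : ℝ)) := by
  constructor
  · refine Asymptotics.IsBigO.of_bound (49 / 4) ?_
    filter_upwards [Filter.eventually_ge_atTop 1] with n hn
    have : NeZero n := ⟨by omega⟩
    have hn0 : (0 : ℝ) < n := Nat.cast_pos.2 hn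
    have h : (Nat.card (OrderType (n + 1)) : ℝ) * (4 * n) ≤ 49 * 2 ^ n := by
      exact_mod_cast card_orderType_mul_le n
    rw [Real.norm_of_nonneg (by positivity), Real.norm_of_nonneg (by positivity),
      div_mul_div_comm, le_div_iff₀ (by positivity)]
    exact h
  · refine Asymptotics.IsBigO.of_bound 4 ?_
    filter_upwards [Filter.eventually_ge_atTop 1] with n hn
    have : NeZero n := ⟨by omega⟩
    have hn0 : (0 : ℝ) < n := Nat.cast_pos.2 hn
    have h : (2 : ℝ) ^ n ≤ (Nat.card (OrderType (n + 1)) : ℝ) * (4 * n) := by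
      exact_mod_cast two_pow_le_card_orderType_mul n
    rw [Real.norm_of_nonneg (by positivity), Real.norm_of_nonneg (by positivity),
      div_le_iff₀ hn0]
    linarith

theorem finite_orderType (n : ℕ) (hn : 1 ≤ n) : Finite (OrderType (n + 1)) := by
  have : NeZero n := ⟨by omega⟩
  obtain ⟨e⟩ := nonempty_orbits_equiv_orderType n
  exact Finite.of_equiv _ e

end

end Conowheel

theorem theorem1 :
    (∀ n : ℕ, 1 ≤ n →
      Finite (Conowheel.OrderType (n + 1)) ∧
      (Nat.card (Conowheel.OrderType (n + 1)) : ℝ) =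
        1 / (4 * (n : ℝ)) *
            ∑ k ∈ n.divisors.filter (fun k => ¬ 2 ∣ k), (Nat.totient k : ℝ) * 2 ^ (n / k)
          + (2 : ℝ) ^ ⌊((n : ℝ) - 3) / 2⌋) ∧
    (fun n : ℕ => (Nat.card (Conowheel.OrderType (n + 1)) : ℝ))
      =Θ[Filter.atTop] (fun n : ℕ => (2 : ℝ) ^ n / (n : ℝ)) := by
  exact ⟨fun n hn => ⟨Conowheel.finite_orderType n hn, Conowheel.card_orderType n hn⟩,
    Conowheel.card_orderType_isTheta⟩
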